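/- **Theorem.** Over $\mathrm{ACA}_0$, weak Martin's pointed tree theorem $\mathrm{wMPT}$ does not imply $\mathrm{ATR}_0$; that is, some axiom of $\mathrm{ATR}_0$ is not a consequence of $\mathrm{ACA}_0+\mathrm{wMPT}$. This is witnessed by $\omega$-models as follows. Here $\mathrm{wMPT}$ is the following sentence of second-order arithmetic: if $T\subseteq\omega^{<\omega}$ is a tree such that $[T]$ is cofinal (for every real $x$ there is an infinite path $y\in[T]$ with $x\le_{\mathrm T}y$), then $T$ has a perfect subtree (a nonempty tree $S\subseteq T$ in which every node has two incompatible extensions in $S$). A real $x\in2^{\omega}$ is *arithmetically generic relative to* $y$ if for every dense set $D\subseteq 2^{<\omega}$ that is arithmetical in $y$ there is an $n$ such that either $x\upharpoonright n\in D$, or no extension of $x\upharpoonright n$ belongs to $D$; *arithmetically generic* means arithmetically generic relative to $\emptyset$. There are sequences $(g_n)_{n\in\omega}$ of elements of $2^\omega$ such that $g_0$ is arithmetically generic and, for every $n$, $g_{n+1}$ is arithmetically generic relative to $g_0\oplus g_1\oplus\dots\oplus g_n$. For every such sequence let $$M=\Big\{x \;\Big|\; \exists n\ \ x\le_{\mathrm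 T}\Big(\bigoplus_{i\le n}g_i\Big)^{(n)}\Big\},$$ where $^{(n)}$ denotes the $n$-th Turing jump. Then the $\omega$-model with second-order part $M$ satisfies $\mathrm{ACA}_0$ and $\mathrm{wMPT}$, it does not contain $\emptyset^{(\omega)}=\{\langle m,n\rangle \mid m\in\emptyset^{(n)}\}$, and it does not satisfy $\mathrm{ATR}_0$. -/

import Mathlib

namespace SOA

/-! ## The language of second-order arithmetic

Formulas are well scoped: `Form n k` has the free number variables `0, …, n - 1` and the free set
variables `0, …, k - 1`. A quantifier binds the variable with the largest index. -/

/-- Number terms with number variables among `0, …, n - 1`. -/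
inductive Term (n : ℕ) : Type
  | var (i : Fin n) : Term n
  | zero : Term n
  | one : Term n
  | add (s t : Term n) : Term n
  | mul (s t : Term n) : Term n

/-- Formulas of second-order arithmetic. `allN` quantifies over numbers, `allS` over sets. -/
inductive Form : ℕ → ℕ → Type
  | eq {n k : ℕ} (s t : Term n) : Form n k
  | lt {n k : ℕ} (s t : Term n) : Form n k
  | mem {n k : ℕ} (t : Term n) (X : Fin k) : Form n k
  | neg {n k : ℕ} (φ : Form n k) : Form n k
  | and {n k : ℕ} (φ ψ : Form n k) : Form n k
  | allN {n k : ℕ} (φ : Form (n + 1) k) : Form n k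
  | allS {n k : ℕ} (φ : Form n (k + 1)) : Form n k

/-- Sentences of second-order arithmetic. -/
abbrev Sentence : Type := Form 0 0

/-- A structure for the language of second-order arithmetic: a first sort `N` with its arithmetical
operations, and a collection `sets` of subsets of `N` as the range of the set variables. -/
structure Model where
  N : Type
  sets : Set (Set N)
  zero : N
  one : N
  add : N → N → N
  mul : N → N → N
  lt : N → N → Prop

/-- The value of a term. -/
def Term.val (M : Model) {n : ℕ} : Term n → (Fin n → M.N) → M.N
  | .var i, v => v i
  | .zero, _ => M.zero
  | .one, _ => M.one
  | .add s t, v => M.add (s.val M v) (t.val M v)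
  | .mul s t, v => M.mul (s.val M v) (t.val M v)

/-- Satisfaction of a formula under a valuation of its number and set variables. -/
def Form.Sat (M : Model) : {n k : ℕ} → Form n k → (Fin n → M.N) → (Fin k → Set M.N) → Prop
  | _, _, .eq s t, v, _ => s.val M v = t.val M v
  | _, _, .lt s t, v, _ => M.lt (s.val M v) (t.val M v)
  | _, _, .mem t X, v, V => t.val M v ∈ V X
  | _, _, .neg φ, v, V => ¬ φ.Sat M v V
  | _, _, .and φ ψ, v, V => φ.Sat M v V ∧ ψ.Sat M v V
  | n, _, .allN φ, v, V => ∀ a : M.N, φ.Sat M (Fin.snoc (α := fun _ : Fin (n + 1) => M.N) v a) V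
  | _, k, .allS φ, v, V => ∀ A ∈ M.sets,
      φ.Sat M v (Fin.snoc (α := fun _ : Fin (k + 1) => Set M.N) V A)

/-- `M ⊨ σ` for a sentence `σ`. -/
def Model.Satisfies (M : Model) (σ : Sentence) : Prop :=
  σ.Sat M Fin.elim0 Fin.elim0

/-- `M ⊨ T` for a set `T` of sentences. -/
def Model.SatisfiesAll (M : Model) (T : Set Sentence) : Prop :=
  ∀ σ ∈ T, M.Satisfies σ

/-- `σ` is a consequence of `T`: it holds in every model of `T`. -/
def Entails (T : Set Sentence) (σ : Sentence) : Prop :=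
  ∀ M : Model, M.SatisfiesAll T → M.Satisfies σ

/-- The `ω`-model whose sets are the members of `S`. -/
def omegaModel (S : Set (Set ℕ)) : Model where
  N := ℕ
  sets := S
  zero := 0
  one := 1
  add := (· + ·)
  mul := (· * ·)
  lt := (· < ·)

/-- A formula is arithmetical if it has no set quantifiers (free set variables are allowed). -/
def Form.IsArithmetical : {n k : ℕ} → Form n k → Prop
  | _, _, .eq _ _ => True
  | _, _, .lt _ _ => True
  | _, _, .mem _ _ => True
  | _, _, .neg φ => φ.IsArithmetical
  | _, _, .and φ ψ => φ.IsArithmetical ∧ ψ.IsArithmetical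
  | _, _, .allN φ => φ.IsArithmetical
  | _, _, .allS _ => False

/-! ### Renaming of variables, and derived connectives -/

/-- Extend a renaming of variables by sending the last variable to the last variable. -/
def extendMap {n m : ℕ} (ρ : Fin n → Fin m) : Fin (n + 1) → Fin (m + 1) :=
  Fin.snoc (α := fun _ : Fin (n + 1) => Fin (m + 1)) (fun i => (ρ i).castSucc) (Fin.last m)

/-- Rename the variables of a term. -/
def Term.rename {n m : ℕ} (ρ : Fin n → Fin m) : Term n → Term m
  | .var i => .var (ρ i)
  | .zero => .zero
  | .one => .one
  | .add s t => .add (s.rename ρ) (t.rename ρ)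
  | .mul s t => .mul (s.rename ρ) (t.rename ρ)

/-- Rename the free variables of a formula. -/
def Form.rename : {n m k l : ℕ} → (Fin n → Fin m) → (Fin k → Fin l) → Form n k → Form m l
  | _, _, _, _, ρ, _, .eq s t => .eq (s.rename ρ) (t.rename ρ)
  | _, _, _, _, ρ, _, .lt s t => .lt (s.rename ρ) (t.rename ρ)
  | _, _, _, _, ρ, τ, .mem t X => .mem (t.rename ρ) (τ X)
  | _, _, _, _, ρ, τ, .neg φ => .neg (φ.rename ρ τ)
  | _, _, _, _, ρ, τ, .and φ ψ => .and (φ.rename ρ τ) (ψ.rename ρ τ)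
  | _, _, _, _, ρ, τ, .allN φ => .allN (φ.rename (extendMap ρ) τ)
  | _, _, _, _, ρ, τ, .allS φ => .allS (φ.rename ρ (extendMap τ))

/-- A term regarded as a term with one more number variable available. -/
def Term.up {n : ℕ} (t : Term n) : Term (n + 1) := t.rename Fin.castSucc

instance {n : ℕ} : Coe (Term n) (Term (n + 1)) := ⟨Term.up⟩

instance {n : ℕ} : Zero (Term n) := ⟨.zero⟩
instance {n : ℕ} : One (Term n) := ⟨.one⟩
instance {n : ℕ} : Add (Term n) := ⟨.add⟩
instance {n : ℕ} : Mul (Term n) := ⟨.mul⟩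

/-- The numeral `1 + ⋯ + 1`. -/
def Term.num {n : ℕ} : ℕ → Term n
  | 0 => 0
  | j + 1 => Term.num j + 1

namespace Form

variable {n k : ℕ}

def or (φ ψ : Form n k) : Form n k := neg (and (neg φ) (neg ψ))
def imp (φ ψ : Form n k) : Form n k := neg (and φ (neg ψ))
def iff (φ ψ : Form n k) : Form n k := and (imp φ ψ) (imp ψ φ)

/-- `∀ x, φ x` over numbers; the bound variable is passed to `φ`. -/
def all (φ : Term (n + 1) → Form (n + 1) k) : Form n k := allN (φ (.var (Fin.last n)))

/-- `∃ x, φ x` over numbers; the bound variable is passed to `φ`. -/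
def ex (φ : Term (n + 1) → Form (n + 1) k) : Form n k := neg (allN (neg (φ (.var (Fin.last n)))))

/-- `∃ X, φ` over sets. -/
def exS (φ : Form n (k + 1)) : Form n k := neg (allS (neg φ))

/-- Universal closure with respect to the number variables. -/
def closeN : {n k : ℕ} → Form n k → Form 0 k
  | 0, _, φ => φ
  | _ + 1, _, φ => closeN (allN φ)

/-- Universal closure with respect to the set variables. -/
def closeS : {k : ℕ} → Form 0 k → Form 0 0
  | 0, φ => φ
  | _ + 1, φ => closeS (allS φ)

/-- The universal closure. -/
def close (φ : Form n k) : Sentence := closeS (closeN φ)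

end Form

local infix:50 " ≐ " => Form.eq
local infix:50 " ≺ " => Form.lt
local infix:50 " ∊ " => Form.mem
local infixr:35 " ⋀ " => Form.and
local infixr:30 " ⋁ " => Form.or
local infixr:25 " ⟹ " => Form.imp
local infix:20 " ⟺ " => Form.iff
local prefix:max "∼" => Form.neg

/-! ### The system `ACA₀` -/

/-- The basic axioms for `0, 1, +, ·, <`. -/
def basicAxioms : Set Sentence :=
  {σ | σ ∈ ([
    Form.all fun m => ∼(m + 1 ≐ 0),
    Form.all fun m => Form.all fun n => ((m : Term 2) + 1 ≐ n + 1) ⟹ ((m : Term 2) ≐ n),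
    Form.all fun m => m + 0 ≐ m,
    Form.all fun m => Form.all fun n => (m : Term 2) + (n + 1) ≐ ((m : Term 2) + n) + 1,
    Form.all fun m => m * 0 ≐ 0,
    Form.all fun m => Form.all fun n => (m : Term 2) * (n + 1) ≐ (m : Term 2) * n + m,
    Form.all fun m => ∼(m ≺ 0),
    Form.all fun m => Form.all fun n =>
      ((m : Term 2) ≺ n + 1) ⟺ (((m : Term 2) ≺ n) ⋁ ((m : Term 2) ≐ n))] : List Sentence)}

/-- The induction axiom for sets. -/
def inductionAxiom : Sentence :=
  Form.allS (((0 : Term 0) ∊ (0 : Fin 1) ⋀ Form.all fun n => (n ∊ (0 : Fin 1)) ⟹ (n + 1 ∊ 0)) ⟹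
    Form.all fun n => n ∊ 0)

/-- The universal closure of `∃ X, ∀ n, (n ∈ X ↔ φ n)`, where `X` does not occur in `φ`. -/
def comprehensionAxiom {p q : ℕ} (φ : Form (p + 1) q) : Sentence :=
  Form.close (n := p) (k := q) (Form.exS (Form.all fun n =>
    (n ∊ Fin.last q) ⟺ φ.rename id Fin.castSucc))

/-- The axioms of `ACA₀`: basic axioms, set induction, arithmetical comprehension. -/
def ACA0 : Set Sentence :=
  basicAxioms ∪ {inductionAxiom} ∪
    {σ | ∃ (p q : ℕ) (φ : Form (p + 1) q), φ.IsArithmetical ∧ σ = comprehensionAxiom φ}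

/-! ### Coding of pairs, finite sequences and functions

The pairing function is `Nat.pair`. A finite sequence is coded by a single number as in
`Encodable (List ℕ)`: the empty sequence by `0`, and `a :: l` by `Nat.pair a (code of l) + 1`.
Thus in `ω` every number codes exactly one finite sequence. Functions are coded by their graphs. -/

section Coding

variable {n k : ℕ}

/-- `z = ⟨x, y⟩`. -/
def pairEq (z x y : Term n) : Form n k :=
  ((x ≺ y) ⋀ (z ≐ y * y + x)) ⋁ (∼(x ≺ y) ⋀ (z ≐ x * x + x + y))

/-- `⟨x, y⟩ ∈ X`. -/
def pairMem (x y : Term n) (X : Fin k) : Form n k :=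
  Form.ex fun p => pairEq p x y ⋀ (p ∊ X)

/-- `z = ⟨x, ⟨y, w⟩⟩`. -/
def tripleEq (z x y w : Term n) : Form n k :=
  Form.ex fun p => pairEq p y w ⋀ pairEq z x p

/-- `y` is the remainder of `a` modulo `(i + 1) * b + 1`, that is, the `i`-th entry of the finite
sequence that Gödel's `β` function assigns to `a, b`. -/
def betaEq (a b i y : Term n) : Form n k :=
  (y ≺ (i + 1) * b + 1) ⋀
    Form.ex fun q => (a : Term (n + 1)) ≐ q * (((i : Term (n + 1)) + 1) * b + 1) + y

/-- The finite sequence `t` extends the finite sequence `s` (not necessarily properly): there are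
`l` and `β`-coded sequences `s = s₀, …, s_l = 0` and `t = t₀, …, t_l` of iterated tails, where
`s_j = ⟨x, s_(j+1)⟩ + 1` and `t_j = ⟨x, t_(j+1)⟩ + 1` with the same first entry `x`. -/
def isPrefix (s t : Term n) : Form n k :=
  Form.ex fun a => Form.ex fun b => Form.ex fun c => Form.ex fun d => Form.ex fun l =>
    betaEq (a : Term (n + 5)) b 0 s ⋀ betaEq (a : Term (n + 5)) b l 0 ⋀
    betaEq (c : Term (n + 5)) d 0 t ⋀
    Form.all fun j => (j ≺ l) ⟹
      Form.ex fun x => Form.ex fun u => Form.ex fun v => Form.ex fun p => Form.ex fun q =>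
        pairEq (p : Term (n + 11)) x u ⋀ pairEq (q : Term (n + 11)) x v ⋀
        betaEq (a : Term (n + 11)) b j (p + 1) ⋀ betaEq (a : Term (n + 11)) b (j + 1) u ⋀
        betaEq (c : Term (n + 11)) d j (q + 1) ⋀ betaEq (c : Term (n + 11)) d (j + 1) v

/-- `f` is the graph of a function. -/
def isFunction (f : Fin k) : Form n k :=
  Form.all fun x => Form.ex fun y => pairMem (x : Term (n + 2)) y f ⋀
    Form.all fun z => pairMem (x : Term (n + 3)) z f ⟹ (z ≐ y)

/-- `s` is a finite initial segment of the function `f`. -/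
def isInitSeg (s : Term n) (f : Fin k) : Form n k :=
  Form.ex fun a => Form.ex fun b => Form.ex fun l =>
    betaEq (a : Term (n + 3)) b 0 s ⋀ betaEq (a : Term (n + 3)) b l 0 ⋀
    Form.all fun j => (j ≺ l) ⟹
      Form.ex fun x => Form.ex fun u => Form.ex fun p =>
        pairEq (p : Term (n + 7)) x u ⋀ betaEq (a : Term (n + 7)) b j (p + 1) ⋀
        betaEq (a : Term (n + 7)) b (j + 1) u ⋀ pairMem (j : Term (n + 7)) x f

/-! ### Turing reducibility inside second-order arithmetic -/

/-- The `j`-th entry of the `β`-coded sequence `a, b` is `⟨e, ⟨x, y⟩⟩` for some `j < i`. -/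
def earlier (a b i e x y : Term n) : Form n k :=
  Form.ex fun j => Form.ex fun z => ((j : Term (n + 2)) ≺ i) ⋀
    betaEq (a : Term (n + 2)) b j z ⋀ tripleEq (z : Term (n + 2)) e x y

/-- The statement `Φ_e^Y(x) = y` follows by one evaluation rule from statements
`Φ_e'^Y(x') = y'` that are listed before place `i` in the `β`-coded sequence `a, b`. The rules
are those of zero, successor, the two projections, the oracle, pairing, composition, primitive
recursion and minimization. -/
def oneStep (Y : Fin k) (a b i e x y : Term n) : Form n k :=
  ((e ≐ 0) ⋀ (y ≐ 0)) ⋁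
  ((e ≐ 1) ⋀ (y ≐ x + 1)) ⋁
  ((e ≐ Term.num 2) ⋀ Form.ex fun z => pairEq (x : Term (n + 1)) y z) ⋁
  ((e ≐ Term.num 3) ⋀ Form.ex fun z => pairEq (x : Term (n + 1)) z y) ⋁
  ((e ≐ Term.num 4) ⋀ (((x ∊ Y) ⋀ (y ≐ 1)) ⋁ (∼(x ∊ Y) ⋀ (y ≐ 0)))) ⋁
  (Form.ex fun c => Form.ex fun d => Form.ex fun p => pairEq (p : Term (n + 3)) c d ⋀
    ((((e : Term (n + 3)) ≐ Term.num 4 * p + Term.num 5) ⋀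
      Form.ex fun u => Form.ex fun w => pairEq (y : Term (n + 5)) u w ⋀
        earlier (a : Term (n + 5)) b i c x u ⋀ earlier (a : Term (n + 5)) b i d x w) ⋁
    (((e : Term (n + 3)) ≐ Term.num 4 * p + Term.num 6) ⋀
      Form.ex fun u =>
        earlier (a : Term (n + 4)) b i d x u ⋀ earlier (a : Term (n + 4)) b i c u y) ⋁
    (((e : Term (n + 3)) ≐ Term.num 4 * p + Term.num 7) ⋀
      Form.ex fun z =>
        (pairEq (x : Term (n + 4)) z 0 ⋀ earlier (a : Term (n + 4)) b i c z y) ⋁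
        (Form.ex fun m => Form.ex fun u => Form.ex fun r => Form.ex fun t =>
          pairEq (x : Term (n + 8)) z (m + 1) ⋀
          pairEq (r : Term (n + 8)) z m ⋀ earlier (a : Term (n + 8)) b i e r u ⋀
          tripleEq (t : Term (n + 8)) z m u ⋀ earlier (a : Term (n + 8)) b i d t y)))) ⋁
  (Form.ex fun c => ((e : Term (n + 1)) ≐ Term.num 4 * c + Term.num 8) ⋀
    (Form.ex fun r => pairEq (r : Term (n + 2)) x y ⋀ earlier (a : Term (n + 2)) b i c r 0) ⋀
    Form.all fun m => ((m : Term (n + 2)) ≺ y) ⟹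
      Form.ex fun r => Form.ex fun u => pairEq (r : Term (n + 4)) x m ⋀
        earlier (a : Term (n + 4)) b i c r (u + 1))

/-- `Φ_e^Y(x) = y`: there is a finite list of statements, each obtained by one evaluation rule
from earlier ones, whose last member is this statement. -/
def computes (Y : Fin k) (e x y : Term n) : Form n k :=
  Form.ex fun a => Form.ex fun b => Form.ex fun l => Form.ex fun s =>
    betaEq (a : Term (n + 4)) b l s ⋀ tripleEq (s : Term (n + 4)) e x y ⋀
    Form.all fun i => ((i : Term (n + 5)) ≺ l + 1) ⟹
      Form.ex fun z => Form.ex fun e' => Form.ex fun x' => Form.ex fun y' =>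
        betaEq (a : Term (n + 9)) b i z ⋀ tripleEq (z : Term (n + 9)) e' x' y' ⋀
        oneStep Y (a : Term (n + 9)) b i e' x' y'

/-- `X ≤_T Y`: some functional `Φ_e^Y` is the characteristic function of `X`. -/
def turingLE (X Y : Fin k) : Form n k :=
  Form.ex fun e => Form.all fun x =>
    ((x ∊ X) ⟹ computes Y (e : Term (n + 2)) x 1) ⋀
    (∼(x ∊ X) ⟹ computes Y (e : Term (n + 2)) x 0)

/-! ### Weak Martin's pointed tree theorem -/

/-- `T` is (the set of codes of) a tree `T ⊆ ω^{<ω}`. -/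
def isTree (T : Fin k) : Form n k :=
  Form.all fun s => Form.all fun t =>
    ((t ∊ T) ⋀ isPrefix (s : Term (n + 2)) t) ⟹ ((s : Term (n + 2)) ∊ T)

/-- `f ∈ [T]`: `f` is an infinite path through `T`. -/
def isPath (f T : Fin k) : Form n k :=
  isFunction f ⋀ Form.all fun s => isInitSeg s f ⟹ (s ∊ T)

/-- `S` is a perfect tree: it is a nonempty tree, and every member of `S` has two incompatible
extensions in `S`. -/
def isPerfectTree (S : Fin k) : Form n k :=
  isTree S ⋀ (Form.ex fun s => s ∊ S) ⋀
  Form.all fun s => (s ∊ S) ⟹ Form.ex fun t => Form.ex fun u =>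
    ((t : Term (n + 3)) ∊ S) ⋀ ((u : Term (n + 3)) ∊ S) ⋀
    isPrefix (s : Term (n + 3)) t ⋀ isPrefix (s : Term (n + 3)) u ⋀
    ∼(isPrefix (t : Term (n + 3)) u) ⋀ ∼(isPrefix (u : Term (n + 3)) t)

/-- `[T]` is cofinal: for every `X` there is a path `f` through `T` with `X ≤_T f`. -/
def isCofinal (T : Fin k) : Form n k :=
  Form.allS (Form.exS (isPath (Fin.last (k + 1)) T.castSucc.castSucc ⋀
    turingLE (Fin.last k).castSucc (Fin.last (k + 1))))

/-- `S ⊆ T`. -/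
def isSubset (S T : Fin k) : Form n k :=
  Form.all fun s => (s ∊ S) ⟹ (s ∊ T)

end Coding

/-- Weak Martin's pointed tree theorem: every tree `T ⊆ ω^{<ω}` with `[T]` cofinal has a perfect
subtree. -/
def wMPT : Sentence :=
  Form.allS ((isTree (0 : Fin 1) ⋀ isCofinal (0 : Fin 1)) ⟹
    Form.exS (isPerfectTree (1 : Fin 2) ⋀ isSubset (1 : Fin 2) 0))

/-! ### The system `ATR₀` -/

section ATR

variable {n k : ℕ}

/-- `i <_X j` for the order relation `X`: `⟨i, j⟩ ∈ X` and `⟨j, i⟩ ∉ X`. -/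
def ltIn (i j : Term n) (X : Fin k) : Form n k :=
  pairMem i j X ⋀ ∼(pairMem j i X)

/-- `X` codes a reflexive linear order of its field `{i | ⟨i, i⟩ ∈ X}`. -/
def isLinearOrder (X : Fin k) : Form n k :=
  (Form.all fun i => Form.all fun j => pairMem (i : Term (n + 2)) j X ⟹
    (pairMem (i : Term (n + 2)) i X ⋀ pairMem (j : Term (n + 2)) j X)) ⋀
  (Form.all fun i => Form.all fun j => Form.all fun l =>
    (pairMem (i : Term (n + 3)) j X ⋀ pairMem (j : Term (n + 3)) l X) ⟹
      pairMem (i : Term (n + 3)) l X) ⋀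
  (Form.all fun i => Form.all fun j =>
    (pairMem (i : Term (n + 2)) j X ⋀ pairMem (j : Term (n + 2)) i X) ⟹
      ((i : Term (n + 2)) ≐ j)) ⋀
  (Form.all fun i => Form.all fun j =>
    (pairMem (i : Term (n + 2)) i X ⋀ pairMem (j : Term (n + 2)) j X) ⟹
      (pairMem (i : Term (n + 2)) j X ⋁ pairMem (j : Term (n + 2)) i X))

/-- `X` codes a well-ordering: a linear order without an infinite descending sequence. -/
def isWellOrder (X : Fin k) : Form n k :=
  isLinearOrder X ⋀
  ∼(Form.exS (isFunction (Fin.last k) ⋀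
    Form.all fun i => Form.all fun x => Form.all fun y =>
      (pairMem (i : Term (n + 3)) x (Fin.last k) ⋀
        pairMem ((i : Term (n + 3)) + 1) y (Fin.last k)) ⟹
          ltIn (y : Term (n + 3)) x X.castSucc))

/-- `Z = {⟨m, i⟩ ∈ Y | i <_X j}`. -/
def isInitialPart (Z Y X : Fin k) (j : Term n) : Form n k :=
  Form.all fun z => (z ∊ Z) ⟺
    ((z ∊ Y) ⋀ Form.ex fun m => Form.ex fun i =>
      pairEq (z : Term (n + 3)) m i ⋀ ltIn (i : Term (n + 3)) j X)

/-- Arithmetical transfinite recursion for `θ(n, Z)`, with parameters. The last number variable of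
`θ` is `n`, the last set variable of `θ` is `Z`. The axiom is the universal closure of: if `X` is a
well-ordering, then there is a `Y` consisting of pairs `⟨n, j⟩` with `j` in the field of `X`, such
that for every `j` in the field of `X`, with `Z = {⟨m, i⟩ ∈ Y | i <_X j}`,
`⟨n, j⟩ ∈ Y ↔ θ(n, Z)` for all `n`. -/
def atrAxiom {p q : ℕ} (θ : Form (p + 1) (q + 1)) : Sentence :=
  -- set variables: the parameters, then `X = q`, `Y = q + 1`, `Z = q + 2`
  Form.close (n := p) (k := q) (Form.allS (isWellOrder (Fin.last q) ⟹
    Form.exS (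
      (Form.all fun z => (z ∊ Fin.last (q + 1)) ⟹
        Form.ex fun m => Form.ex fun j => pairEq (z : Term (p + 3)) m j ⋀
          pairMem (j : Term (p + 3)) j (Fin.last q).castSucc) ⋀
      Form.all fun j => pairMem j j (Fin.last q).castSucc ⟹
        Form.exS (
          isInitialPart (Fin.last (q + 2)) (Fin.last (q + 1)).castSucc
            (Fin.last q).castSucc.castSucc j ⋀
          Form.all fun n =>
            pairMem (n : Term (p + 2)) j (Fin.last (q + 1)).castSucc ⟺
              θ.rename (extendMap Fin.castSucc)
                (extendMap fun i => i.castSucc.castSucc)))))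

/-- The axioms of `ATR₀`: those of `ACA₀` and arithmetical transfinite recursion. -/
def ATR0 : Set Sentence :=
  ACA0 ∪ {σ | ∃ (p q : ℕ) (θ : Form (p + 1) (q + 1)), θ.IsArithmetical ∧ σ = atrAxiom θ}

end ATR

/-! ## Turing reducibility, jumps and arithmetical genericity -/

open Classical in
/-- The characteristic function of a set of natural numbers. -/
noncomputable def charFun (X : Set ℕ) : ℕ →. ℕ := fun n => Part.some (if n ∈ X then 1 else 0)

/-- `X ≤_T Y` for sets of natural numbers. -/
def TuringLE (X Y : Set ℕ) : Prop := TuringReducible (charFun X) (charFun Y)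

/-- Programs with an oracle; the constructors are those of `Nat.RecursiveIn`. -/
inductive OCode : Type
  | zero : OCode
  | succ : OCode
  | left : OCode
  | right : OCode
  | oracle : OCode
  | pair (c d : OCode) : OCode
  | comp (c d : OCode) : OCode
  | prec (c d : OCode) : OCode
  | rfind (c : OCode) : OCode

/-- The partial function computed by a program with oracle `O`. -/
def OCode.eval (O : ℕ →. ℕ) : OCode → ℕ →. ℕ
  | .zero => fun _ => Part.some 0
  | .succ => fun n => Part.some (n + 1)
  | .left => fun n => Part.some n.unpair.1
  | .right => fun n => Part.some n.unpair.2
  | .oracle => O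
  | .pair c d => fun n => Nat.pair <$> c.eval O n <*> d.eval O n
  | .comp c d => fun n => d.eval O n >>= c.eval O
  | .prec c d => fun p =>
      p.unpair.2.rec (c.eval O p.unpair.1) fun y IH => do
        let i ← IH
        d.eval O (Nat.pair p.unpair.1 (Nat.pair y i))
  | .rfind c => fun a => Nat.rfind fun n => (fun m => decide (m = 0)) <$> c.eval O (Nat.pair a n)

/-- The Gödel number of a program. -/
def OCode.index : OCode → ℕ
  | .zero => 0
  | .succ => 1
  | .left => 2
  | .right => 3
  | .oracle => 4
  | .pair c d => 4 * Nat.pair c.index d.index + 5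
  | .comp c d => 4 * Nat.pair c.index d.index + 6
  | .prec c d => 4 * Nat.pair c.index d.index + 7
  | .rfind c => 4 * c.index + 8

/-- The Turing jump: the set of all `e` such that the program with Gödel number `e` and oracle `X`
halts on input `e`. -/
def jump (X : Set ℕ) : Set ℕ :=
  {e | ∃ c : OCode, c.index = e ∧ (c.eval (charFun X) e).Dom}

/-- `∅^(ω) = {⟨m, n⟩ | m ∈ ∅^(n)}`. -/
def emptyOmegaJump : Set ℕ :=
  {z | z.unpair.1 ∈ jump^[z.unpair.2] ∅}

/-- `X ⊕ Y`. -/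
def join (X Y : Set ℕ) : Set ℕ :=
  {z | (∃ x ∈ X, z = 2 * x) ∨ (∃ y ∈ Y, z = 2 * y + 1)}

/-- `g 0 ⊕ g 1 ⊕ ⋯ ⊕ g n`. -/
def joinUpTo (g : ℕ → Set ℕ) : ℕ → Set ℕ
  | 0 => g 0
  | n + 1 => join (joinUpTo g n) (g (n + 1))

/-- `A` is arithmetical in `Y`: it is defined over the natural numbers by an arithmetical formula
with the set parameter `Y`. -/
def ArithmeticalIn (A Y : Set ℕ) : Prop :=
  ∃ φ : Form 1 1, φ.IsArithmetical ∧
    ∀ m : ℕ, m ∈ A ↔ φ.Sat (omegaModel Set.univ) (fun _ => m) (fun _ => Y)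

open Classical in
/-- The binary string `x(0) x(1) … x(n - 1)`. -/
noncomputable def restrict (x : Set ℕ) (n : ℕ) : List Bool :=
  (List.range n).map fun i => decide (i ∈ x)

/-- A set of binary strings is dense if every string has an extension in it. -/
def DenseStrings (D : Set (List Bool)) : Prop :=
  ∀ σ : List Bool, ∃ τ ∈ D, σ <+: τ

/-- `x` is arithmetically generic relative to `Y`: for every dense set `D` of binary strings that is
arithmetical in `Y` there is an `n` such that the restriction of `x` to `n` belongs to `D`, or no
extension of it belongs to `D`. -/
def ArithGenericRel (x Y : Set ℕ) : Prop :=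
  ∀ D : Set (List Bool), ArithmeticalIn (Encodable.encode '' D) Y → DenseStrings D →
    ∃ n, restrict x n ∈ D ∨ ∀ σ, restrict x n <+: σ → σ ∉ D

/-- `g 0` is arithmetically generic, and each `g (n + 1)` is arithmetically generic relative to
`g 0 ⊕ ⋯ ⊕ g n`. -/
def IteratedGeneric (g : ℕ → Set ℕ) : Prop :=
  ArithGenericRel (g 0) ∅ ∧ ∀ n, ArithGenericRel (g (n + 1)) (joinUpTo g n)

/-- The collection of all `X` with `X ≤_T (g 0 ⊕ ⋯ ⊕ g n)^(n)` for some `n`. -/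
def genericIdeal (g : ℕ → Set ℕ) : Set (Set ℕ) :=
  {X | ∃ n, TuringLE X (jump^[n] (joinUpTo g n))}

end SOA

namespace SOA

/-! ### Satisfaction in `ω`-models -/

/-! A fixed arithmetical formula needs only finitely many jumps, so the sets of the model are
exactly those arithmetical in some finite join `joinUpTo g n` (`mem_genericIdeal`). Hence
arithmetical comprehension holds. The rest is Cohen forcing for arithmetical formulas: if `g` is
arithmetically generic relative to `Y`, an arithmetical statement about `Y` and `g` is true iff an
initial segment of `g` forces it, and forcing is arithmetical in `Y` (`Form.sat_iff_forces`,
`Arith.exists_forcing`). Since every string begins some generic set (`exists_arithGenericRel`), what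
a string forces can be tested on actual generics.

For `wMPT`, let `T` be arithmetical in `joinUpTo g n`. By cofinality in the model some path `f`
computes `g (n + 1)`, so `f` is not arithmetical in `joinUpTo g n`. Take the least stage at which
`f` becomes arithmetical; it is some `m + 1` with `n ≤ m`. With `Y = joinUpTo g m`, the path `f` has
a name evaluated at a set generic over `Y`, and some condition `p` forces this name to be a path
through `T`. The segments of the name forced by extensions of `p` form a subtree of `T` arithmetical
in `Y`. It is perfect for suitable `p`, for otherwise some condition would decide the whole path and
`f` would be arithmetical in `Y` (`exists_perfect_subtree`).

For the negative part, suppose that `W` is the only set with some arithmetical property and is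
arithmetical in `Y` joined with a generic. A condition forces the property of a name for `W`, so all
generics through it give the same value, and `W` is already arithmetical in `Y`
(`ArithmeticalIn.of_join_of_unique`). Descending through the stages, such a `W` in the model is
arithmetical. This is impossible if `W` computes an infinite sequence of sets each computing the
jump of its predecessor. Both `∅^(ω)` and any solution of the recursion iterating the jump along `ω`
are such sets (`IteratedGeneric.notMem_genericIdeal`), so the model omits the first and fails an
instance of arithmetical transfinite recursion. -/

/-- The value of a term in the natural numbers. -/
def Term.nval {n : ℕ} : Term n → (Fin n → ℕ) → ℕ
  | .var i, v => v i
  | .zero, _ => 0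
  | .one, _ => 1
  | .add s t, v => s.nval v + t.nval v
  | .mul s t, v => s.nval v * t.nval v

/-- Extend a valuation by a value for the last variable. -/
def snoc {α : Type} {n : ℕ} (v : Fin n → α) (a : α) : Fin (n + 1) → α :=
  Fin.snoc (α := fun _ => α) v a

@[simp] theorem snoc_last {α : Type} {n : ℕ} (v : Fin n → α) (a : α) :
    snoc v a (Fin.last n) = a := Fin.snoc_last (α := fun _ => α) a v

@[simp] theorem snoc_castSucc {α : Type} {n : ℕ} (v : Fin n → α) (a : α) (i : Fin n) :
    snoc v a i.castSucc = v i := Fin.snoc_castSucc (α := fun _ => α) a v i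

/-- Satisfaction in the `ω`-model with the sets `S`. -/
def Form.sat (S : Set (Set ℕ)) : {n k : ℕ} → Form n k → (Fin n → ℕ) → (Fin k → Set ℕ) → Prop
  | _, _, .eq s t, v, _ => s.nval v = t.nval v
  | _, _, .lt s t, v, _ => s.nval v < t.nval v
  | _, _, .mem t X, v, V => t.nval v ∈ V X
  | _, _, .neg φ, v, V => ¬ φ.sat S v V
  | _, _, .and φ ψ, v, V => φ.sat S v V ∧ ψ.sat S v V
  | _, _, .allN φ, v, V => ∀ a : ℕ, φ.sat S (snoc v a) V
  | _, _, .allS φ, v, V => ∀ A ∈ S, φ.sat S v (snoc V A)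

theorem Term.val_omegaModel (S : Set (Set ℕ)) {n : ℕ} (t : Term n) (v : Fin n → ℕ) :
    t.val (omegaModel S) v = t.nval v := by
  induction t with
  | var | zero | one => rfl
  | add s t hs ht => simp only [Term.val, Term.nval, hs, ht]; rfl
  | mul s t hs ht => simp only [Term.val, Term.nval, hs, ht]; rfl

theorem Form.Sat_omegaModel (S : Set (Set ℕ)) {n k : ℕ} (φ : Form n k) (v : Fin n → ℕ)
    (V : Fin k → Set ℕ) : φ.Sat (omegaModel S) v V ↔ φ.sat S v V := by
  induction φ with
  | eq s t => simp only [Form.Sat, Form.sat, Term.val_omegaModel]; rfl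
  | lt s t => simp only [Form.Sat, Form.sat, Term.val_omegaModel]; rfl
  | mem t X => simp only [Form.Sat, Form.sat, Term.val_omegaModel]; rfl
  | neg φ ih => exact not_congr (ih v V)
  | and φ ψ h1 h2 => exact and_congr (h1 v V) (h2 v V)
  | allN φ ih => exact forall_congr' fun a => ih _ V
  | allS φ ih => exact forall₂_congr fun A _ => ih v _

theorem omegaModel_satisfies (S : Set (Set ℕ)) (σ : Sentence) :
    (omegaModel S).Satisfies σ ↔ σ.sat S Fin.elim0 Fin.elim0 :=
  Form.Sat_omegaModel S σ Fin.elim0 Fin.elim0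

/-- Only set quantifiers look at the range of the set variables. Arithmetical formulas can therefore
always be evaluated with the range `Set.univ`. -/
theorem Form.sat_of_isArithmetical (S S' : Set (Set ℕ)) {n k : ℕ} (φ : Form n k)
    (h : φ.IsArithmetical) (v : Fin n → ℕ) (V : Fin k → Set ℕ) :
    φ.sat S v V ↔ φ.sat S' v V := by
  induction φ with
  | eq s t => rfl
  | lt s t => rfl
  | mem t X => rfl
  | neg φ ih => exact not_congr (ih h v V)
  | and φ ψ h1 h2 => exact and_congr (h1 h.1 v V) (h2 h.2 v V)
  | allN φ ih => exact forall_congr' fun a => ih h _ V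
  | allS φ ih => exact h.elim

theorem Term.nval_rename {n m : ℕ} (ρ : Fin n → Fin m) (t : Term n) (v : Fin m → ℕ) :
    (t.rename ρ).nval v = t.nval (v ∘ ρ) := by
  induction t with
  | var | zero | one => rfl
  | add s t hs ht => simp only [Term.rename, Term.nval, hs, ht]
  | mul s t hs ht => simp only [Term.rename, Term.nval, hs, ht]

theorem snoc_comp_extendMap {α : Type} {n m : ℕ} (ρ : Fin n → Fin m) (v : Fin m → α) (a : α) :
    snoc v a ∘ extendMap ρ = snoc (v ∘ ρ) a := by
  funext i
  refine Fin.lastCases ?_ (fun i => ?_) i <;> simp [extendMap]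

theorem Form.sat_rename (S : Set (Set ℕ)) {n m k l : ℕ} (ρ : Fin n → Fin m) (τ : Fin k → Fin l)
    (φ : Form n k) (v : Fin m → ℕ) (V : Fin l → Set ℕ) :
    (φ.rename ρ τ).sat S v V ↔ φ.sat S (v ∘ ρ) (V ∘ τ) := by
  induction φ generalizing m l with
  | eq s t => simp only [Form.rename, Form.sat, Term.nval_rename]
  | lt s t => simp only [Form.rename, Form.sat, Term.nval_rename]
  | mem t X => simp only [Form.rename, Form.sat, Term.nval_rename]; rfl
  | neg φ ih => exact not_congr (ih ..)
  | and φ ψ h1 h2 => exact and_congr (h1 ..) (h2 ..)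
  | allN φ ih => simp only [Form.rename, Form.sat, ih, snoc_comp_extendMap]
  | allS φ ih => simp only [Form.rename, Form.sat, ih, snoc_comp_extendMap]

theorem Form.isArithmetical_rename {n m k l : ℕ} (ρ : Fin n → Fin m) (τ : Fin k → Fin l)
    (φ : Form n k) (h : φ.IsArithmetical) : (φ.rename ρ τ).IsArithmetical := by
  induction φ generalizing m l with
  | eq s t => trivial
  | lt s t => trivial
  | mem t X => trivial
  | neg φ ih => exact ih _ _ h
  | and φ ψ h1 h2 => exact ⟨h1 _ _ h.1, h2 _ _ h.2⟩
  | allN φ ih => exact ih _ _ h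
  | allS φ ih => exact h.elim

/-! ### Satisfaction of derived connectives and of the coding formulas -/

section Semantics

variable {n k : ℕ} (S : Set (Set ℕ)) (v : Fin n → ℕ) (V : Fin k → Set ℕ)

@[simp] theorem Term.nval_up (t : Term n) (a : ℕ) : t.up.nval (snoc v a) = t.nval v := by
  rw [Term.up, Term.nval_rename]
  congr 1
  funext i
  simp

@[simp] theorem Term.nval_last (a : ℕ) : (Term.var (Fin.last n)).nval (snoc v a) = a :=
  snoc_last v a

@[simp] theorem Term.nval_zero : (0 : Term n).nval v = 0 := rfl
@[simp] theorem Term.nval_one : (1 : Term n).nval v = 1 := rfl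
@[simp] theorem Term.nval_add (s t : Term n) : (s + t).nval v = s.nval v + t.nval v := rfl
@[simp] theorem Term.nval_mul (s t : Term n) : (s * t).nval v = s.nval v * t.nval v := rfl
@[simp] theorem Term.nval_num (j : ℕ) : (Term.num j : Term n).nval v = j := by
  induction j with
  | zero => rfl
  | succ j ih => simp [Term.num, ih]

@[simp] theorem sat_eq (s t : Term n) : (Form.eq s t : Form n k).sat S v V ↔ s.nval v = t.nval v :=
  Iff.rfl
@[simp] theorem sat_lt (s t : Term n) : (Form.lt s t : Form n k).sat S v V ↔ s.nval v < t.nval v :=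
  Iff.rfl
@[simp] theorem sat_mem (t : Term n) (X : Fin k) : (Form.mem t X).sat S v V ↔ t.nval v ∈ V X :=
  Iff.rfl
@[simp] theorem sat_neg (φ : Form n k) : φ.neg.sat S v V ↔ ¬ φ.sat S v V := Iff.rfl
@[simp] theorem sat_and (φ ψ : Form n k) :
    (φ.and ψ).sat S v V ↔ φ.sat S v V ∧ ψ.sat S v V := Iff.rfl
@[simp] theorem sat_or (φ ψ : Form n k) :
    (φ.or ψ).sat S v V ↔ φ.sat S v V ∨ ψ.sat S v V := by
  simp only [Form.or, Form.sat]; tauto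
@[simp] theorem sat_imp (φ ψ : Form n k) :
    (φ.imp ψ).sat S v V ↔ (φ.sat S v V → ψ.sat S v V) := by
  simp only [Form.imp, Form.sat]; tauto
@[simp] theorem sat_iff (φ ψ : Form n k) :
    (φ.iff ψ).sat S v V ↔ (φ.sat S v V ↔ ψ.sat S v V) := by
  simp only [Form.iff, sat_and, sat_imp]; tauto
@[simp] theorem sat_allN (φ : Form (n + 1) k) :
    φ.allN.sat S v V ↔ ∀ a, φ.sat S (snoc v a) V := Iff.rfl
@[simp] theorem sat_all (φ : Term (n + 1) → Form (n + 1) k) :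
    (Form.all φ).sat S v V ↔ ∀ a, (φ (.var (Fin.last n))).sat S (snoc v a) V := Iff.rfl
@[simp] theorem sat_ex (φ : Term (n + 1) → Form (n + 1) k) :
    (Form.ex φ).sat S v V ↔ ∃ a, (φ (.var (Fin.last n))).sat S (snoc v a) V := by
  simp [Form.ex]
@[simp] theorem sat_allS (φ : Form n (k + 1)) :
    φ.allS.sat S v V ↔ ∀ A ∈ S, φ.sat S v (snoc V A) := Iff.rfl
@[simp] theorem sat_exS (φ : Form n (k + 1)) :
    φ.exS.sat S v V ↔ ∃ A ∈ S, φ.sat S v (snoc V A) := by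
  simp [Form.exS]

/-- Gödel's `β` function, with its first argument given by two numbers. -/
def betaVal (a b i : ℕ) : ℕ := a % ((i + 1) * b + 1)

@[simp] theorem sat_pairEq (x y z : Term n) :
    (pairEq z x y : Form n k).sat S v V ↔ z.nval v = Nat.pair (x.nval v) (y.nval v) := by
  simp only [pairEq, sat_or, sat_and, sat_neg, sat_lt, sat_eq, Term.nval_add, Term.nval_mul,
    Nat.pair]
  split_ifs <;> tauto

@[simp] theorem sat_pairMem (x y : Term n) (X : Fin k) :
    (pairMem x y X : Form n k).sat S v V ↔ Nat.pair (x.nval v) (y.nval v) ∈ V X := by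
  simp [pairMem]

@[simp] theorem sat_tripleEq (x y z w : Term n) :
    (tripleEq z x y w : Form n k).sat S v V ↔
      z.nval v = Nat.pair (x.nval v) (Nat.pair (y.nval v) (w.nval v)) := by
  simp [tripleEq]

@[simp] theorem sat_betaEq (a b i y : Term n) :
    (betaEq a b i y : Form n k).sat S v V ↔
      betaVal (a.nval v) (b.nval v) (i.nval v) = y.nval v := by
  simp only [betaEq, betaVal, sat_and, sat_ex, sat_lt, sat_eq, Term.nval_add, Term.nval_mul,
    Term.nval_up, Term.nval_last, Term.nval_one]
  constructor
  · rintro ⟨h, q, hq⟩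
    rw [hq, Nat.mul_comm q, Nat.mul_add_mod, Nat.mod_eq_of_lt h]
  · intro h
    refine ⟨h ▸ Nat.mod_lt _ (Nat.succ_pos _),
      a.nval v / ((i.nval v + 1) * b.nval v + 1), ?_⟩
    rw [← h, Nat.mul_comm]
    exact (Nat.div_add_mod _ _).symm

@[simp] theorem sat_earlier (a b i e x y : Term n) :
    (earlier a b i e x y : Form n k).sat S v V ↔
      ∃ j < i.nval v, betaVal (a.nval v) (b.nval v) j =
        Nat.pair (e.nval v) (Nat.pair (x.nval v) (y.nval v)) := by
  simp [earlier]

/-- One evaluation rule for programs with oracle `Y`, from evaluation statements in `E`. -/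
def EvalStep (Y : Set ℕ) (E : ℕ → ℕ → ℕ → Prop) (e x y : ℕ) : Prop :=
  (e = 0 ∧ y = 0) ∨ (e = 1 ∧ y = x + 1) ∨ (e = 2 ∧ ∃ z, x = Nat.pair y z) ∨
  (e = 3 ∧ ∃ z, x = Nat.pair z y) ∨ (e = 4 ∧ ((x ∈ Y ∧ y = 1) ∨ (x ∉ Y ∧ y = 0))) ∨
  (∃ c d, (e = 4 * Nat.pair c d + 5 ∧ ∃ u w, y = Nat.pair u w ∧ E c x u ∧ E d x w) ∨
    (e = 4 * Nat.pair c d + 6 ∧ ∃ u, E d x u ∧ E c u y) ∨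
    (e = 4 * Nat.pair c d + 7 ∧ ∃ z, (x = Nat.pair z 0 ∧ E c z y) ∨
      ∃ m u, x = Nat.pair z (m + 1) ∧ E e (Nat.pair z m) u ∧
        E d (Nat.pair z (Nat.pair m u)) y)) ∨
  (∃ c, e = 4 * c + 8 ∧ E c (Nat.pair x y) 0 ∧ ∀ m < y, ∃ u, E c (Nat.pair x m) (u + 1))

@[simp] theorem sat_oneStep (Y : Fin k) (a b i e x y : Term n) :
    (oneStep Y a b i e x y).sat S v V ↔
      EvalStep (V Y) (fun e x y => ∃ j < i.nval v, betaVal (a.nval v) (b.nval v) j =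
        Nat.pair e (Nat.pair x y)) (e.nval v) (x.nval v) (y.nval v) := by
  simp [oneStep, EvalStep]

theorem sat_computes (Y : Fin k) (e x y : Term n) :
    (computes Y e x y).sat S v V ↔
      ∃ a b l, betaVal a b l = Nat.pair (e.nval v) (Nat.pair (x.nval v) (y.nval v)) ∧
        ∀ i < l + 1, ∃ e x y, betaVal a b i = Nat.pair e (Nat.pair x y) ∧
          EvalStep (V Y) (fun e x y => ∃ j < i, betaVal a b j = Nat.pair e (Nat.pair x y))
            e x y := by
  simp [computes]

end Semantics

/-! ### Programs with an oracle -/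

theorem OCode.recursiveIn (O : ℕ →. ℕ) (c : OCode) : Nat.RecursiveIn {O} (c.eval O) := by
  induction c with
  | zero => exact .zero
  | succ => exact .succ
  | left => exact .left
  | right => exact .right
  | oracle => exact .oracle O rfl
  | pair c d hc hd => exact .pair hc hd
  | comp c d hc hd => exact .comp hc hd
  | prec c d hc hd => exact .prec hc hd
  | rfind c hc => exact .rfind hc

theorem exists_eval_eq {f O : ℕ →. ℕ} (h : Nat.RecursiveIn {O} f) : ∃ c : OCode, c.eval O = f := by
  induction h with
  | zero => exact ⟨.zero, rfl⟩
  | succ => exact ⟨.succ, rfl⟩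
  | left => exact ⟨.left, rfl⟩
  | right => exact ⟨.right, rfl⟩
  | oracle g hg => exact ⟨.oracle, (Set.mem_singleton_iff.1 hg).symm⟩
  | pair _ _ h1 h2 =>
    obtain ⟨c, rfl⟩ := h1
    obtain ⟨d, rfl⟩ := h2
    exact ⟨.pair c d, rfl⟩
  | comp _ _ h1 h2 =>
    obtain ⟨c, rfl⟩ := h1
    obtain ⟨d, rfl⟩ := h2
    exact ⟨.comp c d, rfl⟩
  | prec _ _ h1 h2 =>
    obtain ⟨c, rfl⟩ := h1
    obtain ⟨d, rfl⟩ := h2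
    exact ⟨.prec c d, rfl⟩
  | rfind _ h1 =>
    obtain ⟨c, rfl⟩ := h1
    exact ⟨.rfind c, rfl⟩

theorem exists_forall_eval_eq {f : ℕ →. ℕ} (h : Nat.Partrec f) :
    ∃ c : OCode, ∀ O, c.eval O = f := by
  induction h with
  | zero => exact ⟨.zero, fun _ => rfl⟩
  | succ => exact ⟨.succ, fun _ => rfl⟩
  | left => exact ⟨.left, fun _ => rfl⟩
  | right => exact ⟨.right, fun _ => rfl⟩
  | pair _ _ h1 h2 =>
    obtain ⟨c, hc⟩ := h1
    obtain ⟨d, hd⟩ := h2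
    exact ⟨.pair c d, fun O => by simp only [OCode.eval, hc, hd]; rfl⟩
  | comp _ _ h1 h2 =>
    obtain ⟨c, hc⟩ := h1
    obtain ⟨d, hd⟩ := h2
    exact ⟨.comp c d, fun O => by simp only [OCode.eval, hc, hd]; rfl⟩
  | prec _ _ h1 h2 =>
    obtain ⟨c, hc⟩ := h1
    obtain ⟨d, hd⟩ := h2
    exact ⟨.prec c d, fun O => by simp only [OCode.eval, hc, hd]; rfl⟩
  | rfind _ h1 =>
    obtain ⟨c, hc⟩ := h1
    exact ⟨.rfind c, fun O => by simp only [OCode.eval, hc]; rfl⟩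

theorem turingLE_iff_exists_eval {X Y : Set ℕ} :
    TuringLE X Y ↔ ∃ c : OCode, c.eval (charFun Y) = charFun X := by
  rw [TuringLE, TuringReducible, RecursiveIn.iff_nat]
  exact ⟨exists_eval_eq, fun ⟨c, hc⟩ => hc ▸ c.recursiveIn _⟩

/-! ### The Gödel numbering as a bijection, and evaluation rule by rule -/

theorem OCode.index_injective : Function.Injective OCode.index := by
  intro c
  induction c with
  | zero | succ | left | right | oracle => intro c' h; cases c' <;> simp [OCode.index] at h ⊢
  | pair c d hc hd =>
    intro c' h
    cases c' <;> simp only [OCode.index, Nat.add_right_cancel_iff, Nat.mul_right_inj four_ne_zero,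
      Nat.pair_eq_pair] at h <;> first | omega | rw [hc h.1, hd h.2]
  | comp c d hc hd =>
    intro c' h
    cases c' <;> simp only [OCode.index, Nat.add_right_cancel_iff, Nat.mul_right_inj four_ne_zero,
      Nat.pair_eq_pair] at h <;> first | omega | rw [hc h.1, hd h.2]
  | prec c d hc hd =>
    intro c' h
    cases c' <;> simp only [OCode.index, Nat.add_right_cancel_iff, Nat.mul_right_inj four_ne_zero,
      Nat.pair_eq_pair] at h <;> first | omega | rw [hc h.1, hd h.2]
  | rfind c hc =>
    intro c' h
    cases c' <;> simp only [OCode.index, Nat.add_right_cancel_iff,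
      Nat.mul_right_inj four_ne_zero] at h <;> first | omega | rw [hc h]

/-- Needed because a rule may use only one of two component indices: the base clause of primitive
recursion says nothing about the step program, which must nevertheless exist. -/
theorem OCode.index_surjective : Function.Surjective OCode.index := by
  intro e
  induction e using Nat.strong_induction_on with
  | _ e ih =>
    have hl := fun p : ℕ => Nat.unpair_left_le p
    have hr := fun p : ℕ => Nat.unpair_right_le p
    have h5 : e < 5 ∨ ∃ p, e = 4 * p + 5 ∨ e = 4 * p + 6 ∨ e = 4 * p + 7 ∨ e = 4 * p + 8 := by
      rcases lt_or_ge e 5 with h | h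
      · exact .inl h
      · exact .inr ⟨(e - 5) / 4, by omega⟩
    rcases h5 with h | ⟨p, h⟩
    · interval_cases e
      exacts [⟨.zero, rfl⟩, ⟨.succ, rfl⟩, ⟨.left, rfl⟩, ⟨.right, rfl⟩, ⟨.oracle, rfl⟩]
    · obtain ⟨a, ha⟩ := ih p (by omega)
      obtain ⟨c, hc⟩ := ih p.unpair.1 (by have := hl p; omega)
      obtain ⟨d, hd⟩ := ih p.unpair.2 (by have := hr p; omega)
      rcases h with rfl | rfl | rfl | rfl
      · exact ⟨.pair c d, by simp [OCode.index, hc, hd]⟩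
      · exact ⟨.comp c d, by simp [OCode.index, hc, hd]⟩
      · exact ⟨.prec c d, by simp [OCode.index, hc, hd]⟩
      · exact ⟨.rfind a, by simp [OCode.index, ha]⟩

/-- `Φ_e^Y(x) = y`. -/
def Computes (Y : Set ℕ) (e x y : ℕ) : Prop :=
  ∃ c : OCode, c.index = e ∧ y ∈ c.eval (charFun Y) x

theorem computes_index {Y : Set ℕ} {c : OCode} {x y : ℕ} :
    Computes Y c.index x y ↔ y ∈ c.eval (charFun Y) x :=
  ⟨fun ⟨_, h, hy⟩ => OCode.index_injective h ▸ hy, fun h => ⟨c, rfl, h⟩⟩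

theorem mem_jump {Y : Set ℕ} {e : ℕ} : e ∈ jump Y ↔ ∃ y, Computes Y e e y := by
  show (∃ c : OCode, c.index = e ∧ (c.eval (charFun Y) e).Dom) ↔ _
  simp only [Computes, Part.dom_iff_mem]
  exact ⟨fun ⟨c, h, y, hy⟩ => ⟨y, c, h, hy⟩, fun ⟨y, c, h, hy⟩ => ⟨c, h, y, hy⟩⟩

theorem mem_charFun {Y : Set ℕ} {x y : ℕ} :
    y ∈ charFun Y x ↔ (x ∈ Y ∧ y = 1) ∨ (x ∉ Y ∧ y = 0) := by
  by_cases h : x ∈ Y <;> simp [charFun, h]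

theorem turingLE_iff_computes {X Y : Set ℕ} :
    TuringLE X Y ↔ ∃ e, ∀ x, (x ∈ X → Computes Y e x 1) ∧ (x ∉ X → Computes Y e x 0) := by
  rw [turingLE_iff_exists_eval]
  constructor
  · rintro ⟨c, hc⟩
    refine ⟨c.index, fun x => ?_⟩
    simp only [computes_index, hc, mem_charFun]
    tauto
  · rintro ⟨e, he⟩
    obtain ⟨c, rfl⟩ : ∃ c : OCode, c.index = e := by
      by_cases h : 0 ∈ X
      · obtain ⟨c, h, -⟩ := (he 0).1 h; exact ⟨c, h⟩
      · obtain ⟨c, h, -⟩ := (he 0).2 h; exact ⟨c, h⟩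
    refine ⟨c, funext fun x => ?_⟩
    simp only [computes_index] at he
    by_cases h : x ∈ X
    · exact Part.mem_right_unique ((he x).1 h) (mem_charFun.2 (by tauto))
    · exact Part.mem_right_unique ((he x).2 h) (mem_charFun.2 (by tauto))

theorem mem_eval_pair {O : ℕ →. ℕ} {c d : OCode} {x y : ℕ} :
    y ∈ (OCode.pair c d).eval O x ↔ ∃ u w, y = Nat.pair u w ∧ u ∈ c.eval O x ∧ w ∈ d.eval O x := by
  simp [OCode.eval, Seq.seq]
  constructor
  · rintro ⟨u, hu, w, hw, rfl⟩; exact ⟨u, w, rfl, hu, hw⟩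
  · rintro ⟨u, w, rfl, hu, hw⟩; exact ⟨u, hu, w, hw, rfl⟩

theorem mem_eval_comp {O : ℕ →. ℕ} {c d : OCode} {x y : ℕ} :
    y ∈ (OCode.comp c d).eval O x ↔ ∃ u, u ∈ d.eval O x ∧ y ∈ c.eval O u :=
  Part.mem_bind_iff

theorem mem_eval_prec_zero {O : ℕ →. ℕ} {c d : OCode} {z y : ℕ} :
    y ∈ (OCode.prec c d).eval O (Nat.pair z 0) ↔ y ∈ c.eval O z := by
  simp [OCode.eval]

theorem mem_eval_prec_succ {O : ℕ →. ℕ} {c d : OCode} {z m y : ℕ} :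
    y ∈ (OCode.prec c d).eval O (Nat.pair z (m + 1)) ↔
      ∃ u, u ∈ (OCode.prec c d).eval O (Nat.pair z m) ∧
        y ∈ d.eval O (Nat.pair z (Nat.pair m u)) := by
  simp [OCode.eval]

theorem mem_eval_rfind {O : ℕ →. ℕ} {c : OCode} {x y : ℕ} :
    y ∈ (OCode.rfind c).eval O x ↔ 0 ∈ c.eval O (Nat.pair x y) ∧
      ∀ m < y, ∃ u, u + 1 ∈ c.eval O (Nat.pair x m) := by
  refine Nat.mem_rfind.trans ?_
  simp only [Part.map_eq_map, Part.mem_map_iff]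
  constructor
  · rintro ⟨⟨a, ha, ha'⟩, h⟩
    refine ⟨of_decide_eq_true ha' ▸ ha, fun m hm => ?_⟩
    obtain ⟨b, hb, hb'⟩ := h hm
    exact ⟨b - 1, by rwa [Nat.sub_add_cancel (Nat.pos_of_ne_zero (of_decide_eq_false hb'))]⟩
  · rintro ⟨h0, h⟩
    refine ⟨⟨0, h0, rfl⟩, fun {m} hm => ?_⟩
    obtain ⟨u, hu⟩ := h m hm
    exact ⟨u + 1, hu, rfl⟩

/-! ### Correctness of the formula `computes` -/

theorem EvalStep.mono {Y : Set ℕ} {E E' : ℕ → ℕ → ℕ → Prop} (h : ∀ e x y, E e x y → E' e x y)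
    {e x y : ℕ} (hs : EvalStep Y E e x y) : EvalStep Y E' e x y := by
  rcases hs with hs | hs | hs | hs | hs | ⟨c, d, hs⟩ | ⟨c, h1, h2, h3⟩
  · exact .inl hs
  · exact .inr (.inl hs)
  · exact .inr (.inr (.inl hs))
  · exact .inr (.inr (.inr (.inl hs)))
  · exact .inr (.inr (.inr (.inr (.inl hs))))
  · refine .inr (.inr (.inr (.inr (.inr (.inl ⟨c, d, ?_⟩)))))
    rcases hs with ⟨he, u, w, hy, h1, h2⟩ | ⟨he, u, h1, h2⟩ | ⟨he, z, hs⟩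
    · exact .inl ⟨he, u, w, hy, h _ _ _ h1, h _ _ _ h2⟩
    · exact .inr (.inl ⟨he, u, h _ _ _ h1, h _ _ _ h2⟩)
    · refine .inr (.inr ⟨he, z, ?_⟩)
      rcases hs with ⟨hx, h1⟩ | ⟨m, u, hx, h1, h2⟩
      · exact .inl ⟨hx, h _ _ _ h1⟩
      · exact .inr ⟨m, u, hx, h _ _ _ h1, h _ _ _ h2⟩
  · refine .inr (.inr (.inr (.inr (.inr (.inr ⟨c, h1, h _ _ _ h2, fun m hm => ?_⟩)))))
    obtain ⟨u, hu⟩ := h3 m hm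
    exact ⟨u, h _ _ _ hu⟩

theorem EvalStep.computes {Y : Set ℕ} {e x y : ℕ} (hs : EvalStep Y (Computes Y) e x y) :
    Computes Y e x y := by
  rcases hs with ⟨rfl, rfl⟩ | ⟨rfl, rfl⟩ | ⟨rfl, z, rfl⟩ | ⟨rfl, z, rfl⟩ | ⟨rfl, h⟩ |
    ⟨c, d, hs⟩ | ⟨c, rfl, h2, h3⟩
  · exact ⟨.zero, rfl, by simp [OCode.eval]⟩
  · exact ⟨.succ, rfl, by simp [OCode.eval]⟩
  · exact ⟨.left, rfl, by simp [OCode.eval]⟩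
  · exact ⟨.right, rfl, by simp [OCode.eval]⟩
  · exact ⟨.oracle, rfl, mem_charFun.2 h⟩
  · rcases hs with ⟨rfl, u, w, rfl, ⟨c, rfl, hc⟩, ⟨d, rfl, hd⟩⟩ |
      ⟨rfl, u, ⟨d, rfl, hd⟩, ⟨c, rfl, hc⟩⟩ | ⟨rfl, z, hs⟩
    · exact ⟨.pair c d, rfl, mem_eval_pair.2 ⟨u, w, rfl, hc, hd⟩⟩
    · exact ⟨.comp c d, rfl, mem_eval_comp.2 ⟨u, hd, hc⟩⟩
    · rcases hs with ⟨rfl, ⟨c, rfl, hc⟩⟩ | ⟨m, u, rfl, ⟨p, hp, hu⟩, ⟨d, rfl, hd⟩⟩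
      · obtain ⟨d, rfl⟩ := OCode.index_surjective d
        exact ⟨.prec c d, rfl, mem_eval_prec_zero.2 hc⟩
      · obtain ⟨c, rfl⟩ := OCode.index_surjective c
        obtain rfl : p = .prec c d := OCode.index_injective hp
        exact ⟨.prec c d, rfl, mem_eval_prec_succ.2 ⟨u, hu, hd⟩⟩
  · obtain ⟨c, rfl, hc⟩ := h2
    refine ⟨.rfind c, rfl, mem_eval_rfind.2 ⟨hc, fun m hm => ?_⟩⟩
    obtain ⟨u, hu⟩ := h3 m hm
    exact ⟨u, computes_index.1 hu⟩

/-- A list of evaluation statements, each obtained by one rule from earlier ones. -/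
inductive Derivation (Y : Set ℕ) : List ℕ → Prop
  | nil : Derivation Y []
  | snoc {L : List ℕ} {e x y : ℕ} : Derivation Y L →
      EvalStep Y (fun e x y => Nat.pair e (Nat.pair x y) ∈ L) e x y →
      Derivation Y (L ++ [Nat.pair e (Nat.pair x y)])

theorem Derivation.append {Y : Set ℕ} {L L' : List ℕ} (h : Derivation Y L)
    (h' : Derivation Y L') : Derivation Y (L ++ L') := by
  induction h' with
  | nil => simpa
  | snoc _ hs ih =>
    rw [← List.append_assoc]
    exact ih.snoc (hs.mono fun _ _ _ h => List.mem_append_right _ h)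

/-- The evaluation statement `Φ_e^Y(x) = y` occurs in a derivation. -/
def Derivable (Y : Set ℕ) (e x y : ℕ) : Prop :=
  ∃ L, Derivation Y L ∧ Nat.pair e (Nat.pair x y) ∈ L

theorem Derivation.derivable {Y : Set ℕ} {L : List ℕ} (h : Derivation Y L) {e x y : ℕ}
    (hs : EvalStep Y (fun e x y => Nat.pair e (Nat.pair x y) ∈ L) e x y) : Derivable Y e x y :=
  ⟨_, h.snoc hs, by simp⟩

/-- Minimization has a premise for each smaller argument; these finitely many derivations are
concatenated into one. -/
theorem exists_derivation_forall_lt {Y : Set ℕ} {c x y : ℕ}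
    (h : ∀ m < y, ∃ u, Derivable Y c (Nat.pair x m) (u + 1)) :
    ∃ L, Derivation Y L ∧ ∀ m < y, ∃ u, Nat.pair c (Nat.pair (Nat.pair x m) (u + 1)) ∈ L := by
  induction y with
  | zero => exact ⟨[], .nil, by simp⟩
  | succ y ih =>
    obtain ⟨L, hL, h1⟩ := ih fun m hm => h m (by omega)
    obtain ⟨u, L', hL', h2⟩ := h y (by omega)
    refine ⟨L ++ L', hL.append hL', fun m hm => ?_⟩
    rcases Nat.lt_succ_iff_lt_or_eq.1 hm with hm | rfl
    · obtain ⟨u, hu⟩ := h1 m hm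
      exact ⟨u, List.mem_append_left _ hu⟩
    · exact ⟨u, List.mem_append_right _ h2⟩

theorem derivable_of_mem_eval {Y : Set ℕ} {c : OCode} {x y : ℕ} (h : y ∈ c.eval (charFun Y) x) :
    Derivable Y c.index x y := by
  induction c generalizing x y with
  | zero => exact Derivation.nil.derivable (.inl ⟨rfl, by simpa [OCode.eval] using h⟩)
  | succ => exact Derivation.nil.derivable (.inr (.inl ⟨rfl, by simpa [OCode.eval] using h⟩))
  | left =>
    refine Derivation.nil.derivable (.inr (.inr (.inl ⟨rfl, x.unpair.2, ?_⟩)))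
    have : y = x.unpair.1 := by simpa [OCode.eval] using h
    rw [this, Nat.pair_unpair]
  | right =>
    refine Derivation.nil.derivable (.inr (.inr (.inr (.inl ⟨rfl, x.unpair.1, ?_⟩))))
    have : y = x.unpair.2 := by simpa [OCode.eval] using h
    rw [this, Nat.pair_unpair]
  | oracle =>
    exact Derivation.nil.derivable (.inr (.inr (.inr (.inr (.inl ⟨rfl, mem_charFun.1 h⟩)))))
  | pair c d hc hd =>
    obtain ⟨u, w, rfl, h1, h2⟩ := mem_eval_pair.1 h
    obtain ⟨L, hL, h1⟩ := hc h1
    obtain ⟨L', hL', h2⟩ := hd h2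
    exact (hL.append hL').derivable (.inr (.inr (.inr (.inr (.inr (.inl ⟨c.index, d.index,
      .inl ⟨rfl, u, w, rfl, List.mem_append_left _ h1, List.mem_append_right _ h2⟩⟩))))))
  | comp c d hc hd =>
    obtain ⟨u, h1, h2⟩ := mem_eval_comp.1 h
    obtain ⟨L, hL, h1⟩ := hd h1
    obtain ⟨L', hL', h2⟩ := hc h2
    exact (hL.append hL').derivable (.inr (.inr (.inr (.inr (.inr (.inl ⟨c.index, d.index,
      .inr (.inl ⟨rfl, u, List.mem_append_left _ h1, List.mem_append_right _ h2⟩)⟩))))))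
  | prec c d hc hd =>
    obtain ⟨z, n, rfl⟩ : ∃ z n, x = Nat.pair z n := ⟨_, _, (Nat.pair_unpair x).symm⟩
    induction n generalizing y with
    | zero =>
      obtain ⟨L, hL, h⟩ := hc (mem_eval_prec_zero.1 h)
      exact hL.derivable (.inr (.inr (.inr (.inr (.inr (.inl ⟨c.index, d.index,
        .inr (.inr ⟨rfl, z, .inl ⟨rfl, h⟩⟩)⟩))))))
    | succ n ih =>
      obtain ⟨u, h1, h2⟩ := mem_eval_prec_succ.1 h
      obtain ⟨L, hL, h1⟩ := ih h1
      obtain ⟨L', hL', h2⟩ := hd h2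
      exact (hL.append hL').derivable (.inr (.inr (.inr (.inr (.inr (.inl ⟨c.index, d.index,
        .inr (.inr ⟨rfl, z, .inr ⟨n, u, rfl, List.mem_append_left _ h1,
          List.mem_append_right _ h2⟩⟩)⟩))))))
  | rfind c hc =>
    obtain ⟨h0, h1⟩ := mem_eval_rfind.1 h
    obtain ⟨L, hL, h0⟩ := hc h0
    obtain ⟨L', hL', h1⟩ := exists_derivation_forall_lt fun m hm => (h1 m hm).imp fun _ => hc
    exact (hL.append hL').derivable (.inr (.inr (.inr (.inr (.inr (.inr ⟨c.index, rfl,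
      List.mem_append_left _ h0, fun m hm => (h1 m hm).imp fun _ => List.mem_append_right _⟩))))))

theorem Derivation.get {Y : Set ℕ} {L : List ℕ} (h : Derivation Y L) (i : ℕ) (hi : i < L.length) :
    ∃ e x y, L[i] = Nat.pair e (Nat.pair x y) ∧
      EvalStep Y (fun e x y => ∃ j < i, L[j]? = some (Nat.pair e (Nat.pair x y))) e x y := by
  induction h with
  | nil => simp at hi
  | @snoc L e x y _ hs ih =>
    by_cases h : i < L.length
    · obtain ⟨e, x, y, h1, h2⟩ := ih h
      refine ⟨e, x, y, by rw [List.getElem_append_left h, h1], h2.mono ?_⟩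
      rintro e x y ⟨j, hj, h3⟩
      exact ⟨j, hj, by rw [List.getElem?_append_left (by omega), h3]⟩
    · obtain rfl : i = L.length := by simp at hi; omega
      refine ⟨e, x, y, by simp, hs.mono fun e x y hm => ?_⟩
      obtain ⟨j, hj, h3⟩ := List.getElem_of_mem hm
      exact ⟨j, hj, by rw [List.getElem?_append_left hj, List.getElem?_eq_getElem hj, h3]⟩

theorem exists_betaVal_eq (L : List ℕ) :
    ∃ a b, ∀ (i : ℕ) (hi : i < L.length), betaVal a b i = L[i] :=
  ⟨_, _, fun i hi => Nat.beta_unbeta_coe L ⟨i, hi⟩⟩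

/-- A `β`-coded list of justified statements is sound by strong induction on the position.
Conversely, a halting computation has a finite derivation, and the `β` function codes every finite
list. -/
theorem sat_computes_iff {n k : ℕ} (S : Set (Set ℕ)) (v : Fin n → ℕ) (V : Fin k → Set ℕ)
    (Y : Fin k) (e x y : Term n) :
    (computes Y e x y).sat S v V ↔ Computes (V Y) (e.nval v) (x.nval v) (y.nval v) := by
  rw [sat_computes]
  generalize e.nval v = e, x.nval v = x, y.nval v = y
  constructor
  · rintro ⟨a, b, l, hl, h⟩
    suffices H : ∀ i < l + 1, ∀ e x y, betaVal a b i = Nat.pair e (Nat.pair x y) →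
        Computes (V Y) e x y from H l (Nat.lt_succ_self l) e x y hl
    intro i
    induction i using Nat.strong_induction_on with
    | _ i ih =>
      intro hi e x y hb
      obtain ⟨e', x', y', hb', hs⟩ := h i hi
      simp only [hb', Nat.pair_eq_pair] at hb
      obtain ⟨rfl, rfl, rfl⟩ := hb
      refine (hs.mono ?_).computes
      rintro e x y ⟨j, hj, hb⟩
      exact ih j hj (by omega) e x y hb
  · rintro ⟨c, rfl, hc⟩
    obtain ⟨L, hL, hm⟩ := derivable_of_mem_eval hc
    obtain ⟨l, hl, hm⟩ := List.getElem_of_mem hm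
    obtain ⟨a, b, hab⟩ := exists_betaVal_eq L
    refine ⟨a, b, l, by rw [hab l hl, hm], fun i hi => ?_⟩
    obtain ⟨e, x, y, h1, h2⟩ := hL.get i (by omega)
    refine ⟨e, x, y, by rw [hab i (by omega), h1], h2.mono ?_⟩
    rintro e x y ⟨j, hj, h3⟩
    exact ⟨j, hj, by rw [hab j (by omega), ← Option.some_inj, ← List.getElem?_eq_getElem, h3]⟩

theorem sat_turingLE {n k : ℕ} (S : Set (Set ℕ)) (v : Fin n → ℕ) (V : Fin k → Set ℕ)
    (X Y : Fin k) : (turingLE X Y : Form n k).sat S v V ↔ TuringLE (V X) (V Y) := by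
  simp [turingLE, sat_computes_iff, turingLE_iff_computes]

/-! ### Substitution of definable sets -/

/-- Replace the set variable `X` by the set defined by `ψ X`, whose last number variable is the
element and whose other number variables are renamed by `ρ`. -/
def Form.subst {m k : ℕ} : {n l : ℕ} → (Fin l → Form (m + 1) k) → (Fin m → Fin n) → Form n l →
    Form n k
  | _, _, _, _, .eq s t => .eq s t
  | _, _, _, _, .lt s t => .lt s t
  | _, _, ψ, ρ, .mem t X =>
      Form.ex fun x => .and (.eq x t.up) ((ψ X).rename (extendMap ρ) id)
  | _, _, ψ, ρ, .neg φ => .neg (φ.subst ψ ρ)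
  | _, _, ψ, ρ, .and φ χ => .and (φ.subst ψ ρ) (χ.subst ψ ρ)
  | _, _, ψ, ρ, .allN φ => .allN (φ.subst ψ (fun i => (ρ i).castSucc))
  -- A junk value: substitution is only used for arithmetical formulas.
  | _, _, _, _, .allS _ => .eq .zero .zero

theorem Form.isArithmetical_subst {m k n l : ℕ} (ψ : Fin l → Form (m + 1) k)
    (hψ : ∀ X, (ψ X).IsArithmetical) (ρ : Fin m → Fin n) (φ : Form n l) (h : φ.IsArithmetical) :
    (φ.subst ψ ρ).IsArithmetical := by
  induction φ with
  | eq s t => trivial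
  | lt s t => trivial
  | mem t X => exact ⟨trivial, isArithmetical_rename _ _ _ (hψ X)⟩
  | neg φ ih => exact ih _ hψ _ h
  | and φ χ h1 h2 => exact ⟨h1 _ hψ _ h.1, h2 _ hψ _ h.2⟩
  | allN φ ih => exact ih _ hψ _ h
  | allS φ ih => exact h.elim

theorem Form.sat_subst (S : Set (Set ℕ)) {m k n l : ℕ} (ψ : Fin l → Form (m + 1) k)
    (ρ : Fin m → Fin n) (φ : Form n l) (h : φ.IsArithmetical) (v : Fin n → ℕ)
    (V : Fin k → Set ℕ) :
    (φ.subst ψ ρ).sat S v V ↔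
      φ.sat S v fun X => {x | (ψ X).sat S (SOA.snoc (v ∘ ρ) x) V} := by
  induction φ with
  | eq s t => rfl
  | lt s t => rfl
  | mem t X =>
    simp [Form.subst, sat_rename, snoc_comp_extendMap]
  | neg φ ih => exact not_congr (ih _ _ h _)
  | and φ χ h1 h2 => exact and_congr (h1 _ _ h.1 _) (h2 _ _ h.2 _)
  | allN φ ih =>
    refine forall_congr' fun a => (ih _ _ h _).trans ?_
    have : SOA.snoc v a ∘ (fun i => (ρ i).castSucc) = v ∘ ρ := by funext i; simp
    rw [this]
  | allS φ ih => exact h.elim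

/-! ### Uniformly arithmetical predicates -/

section Arith

variable {α β γ : Type} [Primcodable α] [Primcodable β] [Primcodable γ] {k l : ℕ}

/-- The predicate `P` of an element and of sets is defined by an arithmetical formula. -/
def Arith (P : α → (Fin (k + 1) → Set ℕ) → Prop) : Prop :=
  ∃ φ : Form 1 (k + 1), φ.IsArithmetical ∧
    ∀ a V, P a V ↔ φ.sat Set.univ (fun _ => Encodable.encode a) V

theorem Arith.of_iff {P Q : α → (Fin (k + 1) → Set ℕ) → Prop} (h : Arith P)
    (hPQ : ∀ a V, Q a V ↔ P a V) : Arith Q := by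
  obtain ⟨φ, hφ, h⟩ := h
  exact ⟨φ, hφ, fun a V => (hPQ a V).trans (h a V)⟩

theorem Arith.not {P : α → (Fin (k + 1) → Set ℕ) → Prop} (h : Arith P) :
    Arith fun a V => ¬ P a V := by
  obtain ⟨φ, hφ, h⟩ := h
  exact ⟨φ.neg, hφ, fun a V => not_congr (h a V)⟩

theorem Arith.and {P Q : α → (Fin (k + 1) → Set ℕ) → Prop} (hP : Arith P) (hQ : Arith Q) :
    Arith fun a V => P a V ∧ Q a V := by
  obtain ⟨φ, hφ, hP⟩ := hP
  obtain ⟨ψ, hψ, hQ⟩ := hQ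
  exact ⟨φ.and ψ, ⟨hφ, hψ⟩, fun a V => and_congr (hP a V) (hQ a V)⟩

theorem Arith.or {P Q : α → (Fin (k + 1) → Set ℕ) → Prop} (hP : Arith P) (hQ : Arith Q) :
    Arith fun a V => P a V ∨ Q a V :=
  (hP.not.and hQ.not).not.of_iff fun a V => by tauto

theorem Arith.imp {P Q : α → (Fin (k + 1) → Set ℕ) → Prop} (hP : Arith P) (hQ : Arith Q) :
    Arith fun a V => P a V → Q a V :=
  (hP.and hQ.not).not.of_iff fun a V => by tauto

theorem Arith.iff {P Q : α → (Fin (k + 1) → Set ℕ) → Prop} (hP : Arith P) (hQ : Arith Q) :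
    Arith fun a V => P a V ↔ Q a V :=
  ((hP.imp hQ).and (hQ.imp hP)).of_iff fun a V => by tauto

theorem nval_var_const (c : ℕ) : (Term.var 0 : Term 1).nval (fun _ => c) = c := rfl

theorem Arith.comp {P : β → (Fin (k + 1) → Set ℕ) → Prop} (h : Arith P) {f : α → β}
    (hf : Computable f) : Arith fun a V => P (f a) V := by
  obtain ⟨φ, hφ, h⟩ := h
  obtain ⟨c, hc⟩ := exists_forall_eval_eq hf
  -- The program for `f` behaves the same with every oracle, so set variable `0` serves; this needs
  -- at least one set variable to be present.
  refine ⟨Form.ex fun y => (computes 0 (Term.num c.index) (Term.var 0) y).and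
    (φ.rename (fun _ => Fin.last 1) id), ?_, fun a V => ?_⟩
  · refine ⟨?_, Form.isArithmetical_rename _ _ _ hφ⟩
    repeat' constructor
  · have h0 : (Term.var 0 : Term 2) = (Term.var 0 : Term 1).up := rfl
    have hy : ∀ y, Computes (V 0) c.index (Encodable.encode a) y ↔ y = Encodable.encode (f a) := by
      intro y
      simp [computes_index, hc]
    refine (h _ _).trans ?_
    simp only [h0, sat_ex, sat_and, sat_computes_iff, Term.nval_num, Term.nval_up, Term.nval_last,
      Form.sat_rename, nval_var_const, hy, exists_eq_left, Function.comp_def, snoc_last, id]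

theorem Arith.all_nat {P : α × ℕ → (Fin (k + 1) → Set ℕ) → Prop} (h : Arith P) :
    Arith fun a V => ∀ n, P (a, n) V := by
  obtain ⟨φ, hφ, h⟩ := h
  refine ⟨Form.all fun y => Form.ex fun z => (pairEq z (Term.var 0) y.up).and
    (φ.rename (fun _ => Fin.last 2) id), ?_, fun a V => ?_⟩
  · refine ⟨?_, Form.isArithmetical_rename _ _ _ hφ⟩
    repeat' constructor
  · have h0 : (Term.var 0 : Term 3) = (Term.var 0 : Term 1).up.up := rfl
    simp only [sat_all]
    refine forall_congr' fun n => ?_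
    refine (h _ _).trans ?_
    simp only [h0, sat_ex, sat_and, sat_pairEq, Term.nval_up, Term.nval_last, Form.sat_rename,
      nval_var_const, exists_eq_left, Function.comp_def, snoc_last, id, Encodable.encode_prod_val,
      Encodable.encode_nat]

theorem Arith.all [Inhabited β] {P : α × β → (Fin (k + 1) → Set ℕ) → Prop} (h : Arith P) :
    Arith fun a V => ∀ b, P (a, b) V := by
  have hf : Computable fun p : α × ℕ => (p.1, (Encodable.decode (α := β) p.2).getD default) :=
    (Primrec.fst.pair (Primrec.option_getD.comp (Primrec.decode.comp Primrec.snd)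
      (Primrec.const default))).to_comp
  refine (h.comp hf).all_nat.of_iff fun a V => ⟨fun h n => h _, fun h b => ?_⟩
  simpa using h (Encodable.encode b)

theorem Arith.ex [Inhabited β] {P : α × β → (Fin (k + 1) → Set ℕ) → Prop} (h : Arith P) :
    Arith fun a V => ∃ b, P (a, b) V :=
  h.not.all.not.of_iff fun a V => by simp

theorem Arith.mem_nat (i : Fin (k + 1)) : Arith fun (n : ℕ) V => n ∈ V i :=
  ⟨.mem (.var 0) i, trivial, fun _ _ => Iff.rfl⟩

theorem Arith.mem (i : Fin (k + 1)) {f : α → ℕ} (hf : Computable f) :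
    Arith fun a V => f a ∈ V i :=
  (mem_nat i).comp hf

theorem Arith.of_computable {f : α → Bool} (hf : Computable f) :
    Arith fun a (_ : Fin (k + 1) → Set ℕ) => f a = true := by
  have : Arith fun (n : ℕ) (_ : Fin (k + 1) → Set ℕ) => n = 1 :=
    ⟨.eq (.var 0) .one, trivial, fun _ _ => Iff.rfl⟩
  exact (this.comp (Primrec.encode.to_comp.comp hf)).of_iff fun a V => by
    cases f a <;> simp

theorem Arith.of_primrecPred {p : α → Prop} (hp : PrimrecPred p) :
    Arith fun a (_ : Fin (k + 1) → Set ℕ) => p a := by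
  obtain ⟨_, hp⟩ := hp
  exact (Arith.of_computable hp.to_comp).of_iff fun a V => by simp

theorem Arith.eq_nat {f g : α → ℕ} (hf : Computable f) (hg : Computable g) :
    Arith fun a (_ : Fin (k + 1) → Set ℕ) => f a = g a :=
  (Arith.of_primrecPred (PrimrecRel.comp (R := fun a b : ℕ => a = b) Primrec.eq Primrec.fst
    Primrec.snd)).comp (f := fun a => (f a, g a)) (hf.pair hg)

theorem Arith.lt_nat {f g : α → ℕ} (hf : Computable f) (hg : Computable g) :
    Arith fun a (_ : Fin (k + 1) → Set ℕ) => f a < g a :=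
  (Arith.of_primrecPred (PrimrecRel.comp (R := fun a b : ℕ => a < b) Primrec.nat_lt Primrec.fst
    Primrec.snd)).comp (f := fun a => (f a, g a)) (hf.pair hg)

/-- Arithmetical predicates may be applied to arithmetically defined sets. This is how a property of
a set becomes a property of its name. -/
theorem Arith.subst {P : α → (Fin (l + 1) → Set ℕ) → Prop} (hP : Arith P)
    {Q : Fin (l + 1) → α × ℕ → (Fin (k + 1) → Set ℕ) → Prop} (hQ : ∀ i, Arith (Q i)) :
    Arith fun a V => P a fun i => {x | Q i (a, x) V} := by
  obtain ⟨φ, hφ, hP⟩ := hP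
  choose ψ hψ hQ using hQ
  refine ⟨φ.subst (m := 1) (fun i => Form.ex fun z => (pairEq z (Term.var 0) (Term.var 1)).and
    ((ψ i).rename (fun _ => Fin.last 2) id)) id, ?_, fun a V => ?_⟩
  · refine Form.isArithmetical_subst _ (fun X => ?_) _ _ hφ
    refine ⟨?_, Form.isArithmetical_rename _ _ _ (hψ X)⟩
    repeat' constructor
  · refine (hP _ _).trans (Iff.trans ?_ (Form.sat_subst _ _ _ _ hφ _ _).symm)
    refine iff_of_eq (congrArg _ (funext fun i => Set.ext fun x => ?_))
    have h0 : (Term.var 0 : Term 3) = (Term.var 0 : Term 1).up.up := rfl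
    have h1 : (Term.var 1 : Term 3) = (Term.var (Fin.last 1)).up := rfl
    refine (hQ i (a, x) V).trans (Iff.trans ?_ Set.mem_ofPred_eq.symm.to_iff)
    simp only [h0, h1, sat_ex, sat_and, sat_pairEq, Term.nval_up, Term.nval_last, Form.sat_rename,
      nval_var_const, exists_eq_left, Function.comp_def, snoc_last, id, Encodable.encode_prod_val,
      Encodable.encode_nat]

/-! ### Computation, jump and satisfaction as arithmetical predicates -/

theorem Arith.computes (i : Fin (k + 1)) :
    Arith fun (p : ℕ × ℕ × ℕ) V => Computes (V i) p.1 p.2.1 p.2.2 := by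
  refine ⟨Form.ex fun e => Form.ex fun x => Form.ex fun y =>
    (tripleEq (Term.var 0) (Term.up (Term.up e)) (Term.up x) y).and
      (SOA.computes i (Term.up (Term.up e)) (Term.up x) y), ?_, fun a V => ?_⟩
  · constructor <;> repeat' constructor
  · have h0 : (Term.var 0 : Term 4) = (Term.var 0 : Term 1).up.up.up := rfl
    obtain ⟨e, x, y⟩ := a
    simp only [sat_ex, h0, sat_and, sat_tripleEq, sat_computes_iff, Term.nval_up, Term.nval_last,
      nval_var_const, Encodable.encode_prod_val, Nat.pair_eq_pair, Encodable.encode_nat]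
    simp

theorem Arith.mem_jump (i : Fin (k + 1)) : Arith fun (n : ℕ) V => n ∈ jump (V i) := by
  refine Arith.of_iff (P := fun n V => ∃ y, Computes (V i) n n y) ?_ fun n V => SOA.mem_jump
  exact Arith.ex ((Arith.computes i).comp
    (f := fun p : ℕ × ℕ => (p.1, p.1, p.2))
    (Computable.fst.pair (Computable.fst.pair Computable.snd)))

theorem primrec_snoc {n : ℕ} : Primrec fun p : (Fin n → ℕ) × ℕ => snoc p.1 p.2 := by
  refine Primrec.fin_curry.2 (Primrec₂.swap (Primrec.fin_curry₁.2 fun i => ?_))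
  refine Fin.lastCases ?_ (fun i => ?_) i
  · simpa using Primrec.snd
  · simpa using Primrec.fin_app.comp Primrec.fst (Primrec.const i)

theorem Term.primrec_nval {n : ℕ} (t : Term n) : Primrec t.nval := by
  induction t with
  | var i => exact Primrec.fin_app.comp Primrec.id (Primrec.const i)
  | zero => exact Primrec.const 0
  | one => exact Primrec.const 1
  | add s t hs ht => exact Primrec.nat_add.comp hs ht
  | mul s t hs ht => exact Primrec.nat_mul.comp hs ht

/-- Brings formulas with several number variables under `Arith`, with the valuation coded as one
element. The map `τ` leaves room for an unused set variable, since `Arith` requires at least one. -/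
theorem Arith.sat_comp {n l : ℕ} (φ : Form n l) (h : φ.IsArithmetical) (τ : Fin l → Fin (k + 1)) :
    Arith fun (v : Fin n → ℕ) V => φ.sat Set.univ v (V ∘ τ) := by
  induction φ with
  | eq s t => exact Arith.eq_nat s.primrec_nval.to_comp t.primrec_nval.to_comp
  | lt s t => exact Arith.lt_nat s.primrec_nval.to_comp t.primrec_nval.to_comp
  | mem t X => exact Arith.mem (τ X) t.primrec_nval.to_comp
  | neg φ ih => exact (ih h τ).not
  | and φ ψ h1 h2 => exact (h1 h.1 τ).and (h2 h.2 τ)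
  | allN φ ih => exact ((ih h τ).comp primrec_snoc.to_comp).all
  | allS φ ih => exact h.elim

end Arith

/-! ### Turing reducibility and the jump -/

theorem TuringLE.refl (X : Set ℕ) : TuringLE X X := TuringReducible.refl _

theorem TuringLE.trans {X Y Z : Set ℕ} (h : TuringLE X Y) (h' : TuringLE Y Z) : TuringLE X Z :=
  TuringReducible.trans h h'

theorem TuringLE.of_computable {X Y : Set ℕ} {f : ℕ → ℕ} (hf : Computable f)
    (h : ∀ n, n ∈ X ↔ f n ∈ Y) : TuringLE X Y := by
  obtain ⟨c, hc⟩ := exists_forall_eval_eq (Partrec.nat_iff.1 hf)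
  refine turingLE_iff_exists_eval.2 ⟨.comp .oracle c, funext fun n => Part.ext fun y => ?_⟩
  rw [mem_eval_comp, hc]
  simp [OCode.eval, mem_charFun, h]

/-- The program for `X` is followed by the oracle-free program for `f`, which turns values of one
characteristic function into values of the other. -/
theorem TuringLE.map {X Z : Set ℕ} (h : TuringLE X Z) {f : ℕ → ℕ} (hf : Computable f)
    {W : Set ℕ} (hW : ∀ n a, a ∈ charFun X n → f a ∈ charFun W n) : TuringLE W Z := by
  obtain ⟨c, hc⟩ := turingLE_iff_exists_eval.1 h
  obtain ⟨d, hd⟩ := exists_forall_eval_eq (Partrec.nat_iff.1 hf)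
  refine turingLE_iff_exists_eval.2 ⟨.comp d c, funext fun n => ?_⟩
  obtain ⟨a, ha⟩ : ∃ a, a ∈ charFun X n := ⟨_, Part.mem_some _⟩
  refine Part.mem_right_unique (a := f a) (mem_eval_comp.2 ⟨a, hc ▸ ha, ?_⟩) (hW n a ha)
  simp [hd]

theorem TuringLE.compl {X Z : Set ℕ} (h : TuringLE X Z) : TuringLE Xᶜ Z := by
  refine h.map (f := fun n => 1 - n)
    (Primrec.nat_sub.comp (Primrec.const 1) Primrec.id).to_comp fun n a ha => ?_
  rw [mem_charFun] at ha ⊢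
  simp only [Set.mem_compl_iff]
  rcases ha with ⟨h, rfl⟩ | ⟨h, rfl⟩ <;> simp [h]

theorem TuringLE.inter {X Y Z : Set ℕ} (hX : TuringLE X Z) (hY : TuringLE Y Z) :
    TuringLE (X ∩ Y) Z := by
  obtain ⟨c, hc⟩ := turingLE_iff_exists_eval.1 hX
  obtain ⟨d, hd⟩ := turingLE_iff_exists_eval.1 hY
  obtain ⟨m, hm⟩ := exists_forall_eval_eq (Partrec.nat_iff.1 (Computable.partrec
    (f := fun n : ℕ => n.unpair.1 * n.unpair.2) (Primrec.nat_mul.comp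
      (Primrec.fst.comp Primrec.unpair) (Primrec.snd.comp Primrec.unpair)).to_comp))
  refine turingLE_iff_exists_eval.2 ⟨.comp m (.pair c d), funext fun n => ?_⟩
  obtain ⟨a, ha⟩ : ∃ a, a ∈ charFun X n := ⟨_, Part.mem_some _⟩
  obtain ⟨b, hb⟩ : ∃ b, b ∈ charFun Y n := ⟨_, Part.mem_some _⟩
  refine Part.mem_right_unique (a := a * b) (mem_eval_comp.2 ⟨Nat.pair a b,
    mem_eval_pair.2 ⟨a, b, rfl, hc ▸ ha, hd ▸ hb⟩, ?_⟩) ?_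
  · simp [hm]
  · rw [mem_charFun] at ha hb ⊢
    rcases ha with ⟨h, rfl⟩ | ⟨h, rfl⟩ <;> rcases hb with ⟨h', rfl⟩ | ⟨h', rfl⟩ <;> simp [h, h']

/-- Unbounded search looks for the value `0` of a characteristic function, hence for a non-member;
this is why complements appear when a member is sought. -/
theorem exists_mem_eval_rfind {O : ℕ →. ℕ} {c : OCode} {Z : Set ℕ} (hc : c.eval O = charFun Z)
    {x : ℕ} : (∃ y, y ∈ (OCode.rfind c).eval O x) ↔ ∃ y, Nat.pair x y ∉ Z := by
  classical
  simp only [mem_eval_rfind, hc, mem_charFun]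
  constructor
  · rintro ⟨y, h, -⟩
    exact ⟨y, by simpa using h⟩
  · intro h
    exact ⟨Nat.find h, by simpa using Nat.find_spec h,
      fun m hm => ⟨0, .inl ⟨not_not.1 (Nat.find_min h hm), rfl⟩⟩⟩

/-- A program computing the constant function with value `n`. -/
def OCode.const : ℕ → OCode
  | 0 => .zero
  | n + 1 => .comp .succ (const n)

theorem OCode.eval_const (O : ℕ →. ℕ) (n x : ℕ) : (OCode.const n).eval O x = Part.some n := by
  induction n with
  | zero => rfl
  | succ n ih =>
    have h : n + 1 ∈ (OCode.comp .succ (.const n)).eval O x :=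
      mem_eval_comp.2 ⟨n, ih ▸ Part.mem_some n, Part.mem_some _⟩
    exact Part.eq_some_iff.2 h

theorem OCode.primrec_index_const : Primrec fun n => (OCode.const n).index := by
  refine (Primrec.nat_rec₁ (f := fun _ i => 4 * Nat.pair 1 i + 6) 0 ?_).of_eq fun n => ?_
  · exact Primrec.nat_add.comp (Primrec.nat_mul.comp (Primrec.const 4)
      (Primrec₂.natPair.comp (Primrec.const 1) Primrec.snd)) (Primrec.const 6)
  · induction n with
    | zero => rfl
    | succ n ih => simp only [ih, OCode.const, OCode.index]

/-- One number quantifier costs one jump. For each `a` a program ignores its input and searches for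
`b`; its index is computable from `a`, and the index lies in the jump iff the search succeeds. -/
theorem TuringLE.exists_jump {R C : Set ℕ} (h : TuringLE R C) :
    TuringLE {a | ∃ b, Nat.pair a b ∈ R} (jump C) := by
  obtain ⟨c, hc⟩ := turingLE_iff_exists_eval.1 h.compl
  refine TuringLE.of_computable (f := fun a => (OCode.comp (.rfind c) (.const a)).index) ?_ ?_
  · exact (Primrec.nat_add.comp (Primrec.nat_mul.comp (Primrec.const 4) (Primrec₂.natPair.comp
      (Primrec.const _) OCode.primrec_index_const)) (Primrec.const 6)).to_comp
  · intro a
    rw [mem_jump]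
    simp only [computes_index, mem_eval_comp, OCode.eval_const, Part.mem_some_iff, exists_eq_left,
      exists_mem_eval_rfind hc]
    simp

theorem turingLE_jump (X : Set ℕ) : TuringLE X (jump X) := by
  have h : TuringLE {z : ℕ | z.unpair.1 ∈ X} X :=
    .of_computable (Primrec.fst.comp Primrec.unpair).to_comp fun n => Iff.rfl
  -- The quantified second coordinate is a dummy.
  simpa using h.exists_jump

theorem not_turingLE_jump (X : Set ℕ) : ¬ TuringLE (jump X) X := by
  intro h
  have h' : TuringLE {z : ℕ | z.unpair.1 ∈ jump X} X :=
    TuringLE.trans (.of_computable (Primrec.fst.comp Primrec.unpair).to_comp fun n => Iff.rfl) h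
  obtain ⟨c, hc⟩ := turingLE_iff_exists_eval.1 h'
  -- Diagonalization: the search with a dummy second coordinate halts on `e` iff `e` is not in the
  -- jump, and it is run on its own index.
  have := mem_jump (Y := X) (e := (OCode.rfind c).index)
  simp only [computes_index, exists_mem_eval_rfind hc] at this
  simp at this

/-! ### Arithmetical sets are computable from iterated jumps -/

section Chain

variable {α β : Type} [Primcodable α] [Inhabited α] [Primcodable β] [Inhabited β]

/-- The predicate `P` is decidable with oracle `C`. -/
def DecidableIn (C : Set ℕ) (P : α → Prop) : Prop :=
  TuringLE {m | P ((Encodable.decode (α := α) m).getD default)} C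

theorem DecidableIn.comp {C : Set ℕ} {P : β → Prop} (h : DecidableIn C P) {f : α → β}
    (hf : Computable f) : DecidableIn C fun a => P (f a) := by
  refine TuringLE.trans (.of_computable (f := fun m => Encodable.encode (f
    ((Encodable.decode (α := α) m).getD default))) ?_ fun n => ?_) h
  · exact Primrec.encode.to_comp.comp (hf.comp
      (Primrec.option_getD.comp Primrec.decode (Primrec.const default)).to_comp)
  · simp

theorem DecidableIn.of_mem {C X : Set ℕ} (h : TuringLE X C) {f : α → ℕ} (hf : Computable f) :
    DecidableIn C fun a => f a ∈ X :=
  TuringLE.trans (.of_computable (hf.comp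
      (Primrec.option_getD.comp Primrec.decode (Primrec.const default)).to_comp) fun _ => Iff.rfl) h

theorem DecidableIn.of_primrecPred {C : Set ℕ} {p : α → Prop} (hp : PrimrecPred p) :
    DecidableIn C p := by
  obtain ⟨_, hp⟩ := hp
  have h0 : TuringLE {1} C := by
    refine turingLE_iff_exists_eval.2 ?_
    obtain ⟨c, hc⟩ := exists_forall_eval_eq (Partrec.nat_iff.1 (Computable.partrec
      (f := fun n : ℕ => if n = 1 then 1 else 0) (Primrec.ite (Primrec.eq.comp Primrec.id
        (Primrec.const 1)) (Primrec.const 1) (Primrec.const 0)).to_comp))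
    refine ⟨c, (hc _).trans (funext fun n => ?_)⟩
    by_cases h : n = 1 <;> simp [charFun, h]
  have h1 : DecidableIn C fun a => Encodable.encode (decide (p a)) ∈ ({1} : Set ℕ) :=
    .of_mem h0 (Primrec.encode.comp hp).to_comp
  convert h1 using 2 with a
  by_cases h : p a <;> simp [h]

theorem DecidableIn.not {C : Set ℕ} {P : α → Prop} (h : DecidableIn C P) :
    DecidableIn C fun a => ¬ P a :=
  TuringLE.compl h

theorem DecidableIn.and {C : Set ℕ} {P Q : α → Prop} (hP : DecidableIn C P)
    (hQ : DecidableIn C Q) : DecidableIn C fun a => P a ∧ Q a :=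
  TuringLE.inter hP hQ

theorem DecidableIn.exists {C : Set ℕ} {P : α × ℕ → Prop} (h : DecidableIn C P) :
    DecidableIn (jump C) fun a => ∃ b, P (a, b) := by
  have : Computable fun z : ℕ =>
      ((Encodable.decode (α := α) z.unpair.1).getD default, z.unpair.2) :=
    ((Primrec.option_getD.comp (Primrec.decode.comp (Primrec.fst.comp Primrec.unpair))
      (Primrec.const default)).pair (Primrec.snd.comp Primrec.unpair)).to_comp
  have := TuringLE.exists_jump (h.comp this)
  simpa [DecidableIn] using this

theorem DecidableIn.mono {C C' : Set ℕ} {P : α → Prop} (h : DecidableIn C P)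
    (hC : TuringLE C C') : DecidableIn C' P :=
  TuringLE.trans h hC

/-- A sequence of sets each of which computes the jump of the preceding one. -/
def JumpChain (C : ℕ → Set ℕ) : Prop := ∀ i, TuringLE (jump (C i)) (C (i + 1))

theorem JumpChain.mono {C : ℕ → Set ℕ} (hC : JumpChain C) {i j : ℕ} (h : i ≤ j) :
    TuringLE (C i) (C j) := by
  induction j, h using Nat.le_induction with
  | base => exact .refl _
  | succ j _ ih => exact ih.trans ((turingLE_jump _).trans (hC j))

theorem jumpChain_iterate (X : Set ℕ) : JumpChain fun n => jump^[n] X := by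
  intro i
  simp only [Function.iterate_succ_apply']
  exact .refl _

/-- The level `j` counts jumps for quantifiers and depends on the formula alone. It is stated for
arbitrary jump chains, so that it applies to iterated jumps and equally to the stages of a solution
of transfinite recursion. -/
theorem exists_forall_decidableIn_sat {n k : ℕ} (φ : Form n k) (h : φ.IsArithmetical) :
    ∃ j, ∀ C : ℕ → Set ℕ, JumpChain C → ∀ V : Fin k → Set ℕ, (∀ i, TuringLE (V i) (C 0)) →
      DecidableIn (C j) fun v : Fin n → ℕ => φ.sat Set.univ v V := by
  induction φ with
  | eq s t => exact ⟨0, fun C _ V _ => .of_primrecPred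
      (Primrec.eq.comp s.primrec_nval t.primrec_nval)⟩
  | lt s t => exact ⟨0, fun C _ V _ => .of_primrecPred
      (Primrec.nat_lt.comp s.primrec_nval t.primrec_nval)⟩
  | mem t X => exact ⟨0, fun C _ V hV => .of_mem (hV X) t.primrec_nval.to_comp⟩
  | neg φ ih =>
    obtain ⟨j, hj⟩ := ih h
    exact ⟨j, fun C hC V hV => (hj C hC V hV).not⟩
  | and φ ψ h1 h2 =>
    obtain ⟨i, hi⟩ := h1 h.1
    obtain ⟨j, hj⟩ := h2 h.2
    exact ⟨max i j, fun C hC V hV => ((hi C hC V hV).mono (hC.mono (le_max_left ..))).and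
      ((hj C hC V hV).mono (hC.mono (le_max_right ..)))⟩
  | allN φ ih =>
    obtain ⟨j, hj⟩ := ih h
    refine ⟨j + 1, fun C hC V hV => ?_⟩
    have := ((hj C hC V hV).comp primrec_snoc.to_comp).not.exists.not.mono (hC j)
    simpa using this
  | allS φ ih => exact h.elim

theorem Arith.exists_forall_turingLE {k : ℕ} {P : ℕ → (Fin (k + 1) → Set ℕ) → Prop}
    (h : Arith P) : ∃ j, ∀ C : ℕ → Set ℕ, JumpChain C →
      ∀ V : Fin (k + 1) → Set ℕ, (∀ i, TuringLE (V i) (C 0)) → TuringLE {m | P m V} (C j) := by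
  obtain ⟨φ, hφ, hP⟩ := h
  obtain ⟨j, hj⟩ := exists_forall_decidableIn_sat φ hφ
  refine ⟨j, fun C hC V hV => ?_⟩
  have := (hj C hC V hV).comp (f := fun (m : ℕ) (_ : Fin 1) => m)
    (Primrec.fin_curry.2 Primrec.fst.to₂).to_comp
  simpa [DecidableIn, hP] using this

end Chain

/-! ### Sets arithmetical in a set -/

theorem arithmeticalIn_iff {A Y : Set ℕ} :
    ArithmeticalIn A Y ↔ ∃ P : ℕ → (Fin 1 → Set ℕ) → Prop, Arith P ∧
      ∀ m, m ∈ A ↔ P m fun _ => Y := by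
  simp only [ArithmeticalIn, Form.Sat_omegaModel]
  constructor
  · rintro ⟨φ, hφ, h⟩
    exact ⟨_, ⟨φ, hφ, fun m V => Iff.rfl⟩, h⟩
  · rintro ⟨P, ⟨φ, hφ, hP⟩, h⟩
    exact ⟨φ, hφ, fun m => (h m).trans (hP _ _)⟩

/-- Replacing each set by its definition from `Y` gives a definition from `Y`. -/
theorem Arith.arithmeticalIn {k : ℕ} {P : ℕ → (Fin (k + 1) → Set ℕ) → Prop} (hP : Arith P)
    {V : Fin (k + 1) → Set ℕ} {Y : Set ℕ} (hV : ∀ i, ArithmeticalIn (V i) Y) :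
    ArithmeticalIn {m | P m V} Y := by
  simp only [arithmeticalIn_iff] at hV
  choose Q hQ hV using hV
  refine arithmeticalIn_iff.2 ⟨_, hP.subst (Q := fun i p => Q i p.2)
    fun i => (hQ i).comp Computable.snd, fun m => ?_⟩
  have : V = fun i => {x | Q i x fun _ => Y} := funext fun i => Set.ext fun x => hV i x
  simp [← this]

theorem ArithmeticalIn.refl (Y : Set ℕ) : ArithmeticalIn Y Y :=
  arithmeticalIn_iff.2 ⟨_, Arith.mem_nat 0, fun _ => Iff.rfl⟩

theorem ArithmeticalIn.trans {X Y Z : Set ℕ} (h : ArithmeticalIn X Y) (h' : ArithmeticalIn Y Z) :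
    ArithmeticalIn X Z := by
  obtain ⟨P, hP, h⟩ := arithmeticalIn_iff.1 h
  have := hP.arithmeticalIn (V := fun _ => Y) fun _ => h'
  rwa [show X = {m | P m fun _ => Y} from Set.ext h]

theorem TuringLE.arithmeticalIn {X Y : Set ℕ} (h : TuringLE X Y) : ArithmeticalIn X Y := by
  obtain ⟨e, he⟩ := turingLE_iff_computes.1 h
  -- Membership means that the value is `1`; values are unique, so this excludes `0`.
  refine arithmeticalIn_iff.2 ⟨_, (Arith.computes 0).comp (f := fun x : ℕ => (e, x, 1))
    (Primrec.pair (.const e) (.pair .id (.const 1))).to_comp, fun x => ⟨(he x).1, fun h => ?_⟩⟩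
  by_contra hx
  obtain ⟨c, hc, h0⟩ := (he x).2 hx
  obtain ⟨c', hc', h1⟩ := h
  rw [← OCode.index_injective (hc.trans hc'.symm)] at h1
  exact absurd (Part.mem_unique h0 h1) zero_ne_one

theorem arithmeticalIn_jump (X : Set ℕ) : ArithmeticalIn (jump X) X :=
  arithmeticalIn_iff.2 ⟨_, Arith.mem_jump 0, fun _ => Iff.rfl⟩

theorem arithmeticalIn_iterate_jump (X : Set ℕ) (n : ℕ) : ArithmeticalIn (jump^[n] X) X := by
  induction n with
  | zero => exact .refl X
  | succ n ih =>
    rw [Function.iterate_succ_apply']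
    exact (arithmeticalIn_jump _).trans ih

theorem ArithmeticalIn.exists_turingLE {X Y : Set ℕ} (h : ArithmeticalIn X Y) :
    ∃ j, ∀ C : ℕ → Set ℕ, JumpChain C → TuringLE Y (C 0) → TuringLE X (C j) := by
  obtain ⟨P, hP, h⟩ := arithmeticalIn_iff.1 h
  obtain ⟨j, hj⟩ := hP.exists_forall_turingLE
  refine ⟨j, fun C hC hY => ?_⟩
  rw [show X = {m | P m fun _ => Y} from Set.ext h]
  exact hj C hC _ fun _ => hY

/-- A set arithmetical in `Y` is given by a number of jumps and the index of a program. -/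
theorem countable_arithmeticalIn (Y : Set ℕ) : {A | ArithmeticalIn A Y}.Countable := by
  refine (Set.countable_range fun p : ℕ × ℕ =>
    {x | Computes (jump^[p.1] Y) p.2 x 1}).mono fun A hA => ?_
  obtain ⟨j, hj⟩ := hA.exists_turingLE
  obtain ⟨c, hc⟩ := turingLE_iff_exists_eval.1 (hj _ (jumpChain_iterate Y) (.refl _))
  refine ⟨(j, c.index), Set.ext fun x => ?_⟩
  simp [computes_index, hc, mem_charFun]

/-! ### Joins and the generic ideal -/

theorem two_mul_mem_join {X Y : Set ℕ} {x : ℕ} : 2 * x ∈ join X Y ↔ x ∈ X := by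
  constructor
  · rintro (⟨y, hy, h⟩ | ⟨y, hy, h⟩)
    · rwa [show x = y by omega]
    · omega
  · exact fun h => .inl ⟨x, h, rfl⟩

theorem two_mul_add_one_mem_join {X Y : Set ℕ} {x : ℕ} : 2 * x + 1 ∈ join X Y ↔ x ∈ Y := by
  constructor
  · rintro (⟨y, hy, h⟩ | ⟨y, hy, h⟩)
    · omega
    · rwa [show x = y by omega]
  · exact fun h => .inr ⟨x, h, rfl⟩

theorem turingLE_join_left (X Y : Set ℕ) : TuringLE X (join X Y) :=
  .of_computable (Primrec.nat_mul.comp (.const 2) .id).to_comp fun _ => two_mul_mem_join.symm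

theorem turingLE_join_right (X Y : Set ℕ) : TuringLE Y (join X Y) :=
  .of_computable (Primrec.succ.comp (Primrec.nat_mul.comp (.const 2) .id)).to_comp
    fun _ => two_mul_add_one_mem_join.symm

theorem turingLE_joinUpTo (g : ℕ → Set ℕ) {n m : ℕ} (h : n ≤ m) :
    TuringLE (joinUpTo g n) (joinUpTo g m) := by
  induction m, h using Nat.le_induction with
  | base => exact .refl _
  | succ m _ ih => exact ih.trans (turingLE_join_left _ _)

/-- The number of jumps and the length of the join are tied together in the model, but both may be
raised to their maximum. -/
theorem mem_genericIdeal {g : ℕ → Set ℕ} {X : Set ℕ} :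
    X ∈ genericIdeal g ↔ ∃ n, ArithmeticalIn X (joinUpTo g n) := by
  constructor
  · rintro ⟨n, h⟩
    exact ⟨n, h.arithmeticalIn.trans (arithmeticalIn_iterate_jump _ _)⟩
  · rintro ⟨n, h⟩
    obtain ⟨j, hj⟩ := h.exists_turingLE
    have hC := jumpChain_iterate (joinUpTo g (max n j))
    exact ⟨max n j, (hj _ hC (turingLE_joinUpTo g (le_max_left ..))).trans
      (hC.mono (le_max_right ..))⟩

/-- A set is not arithmetical if it computes all members of a jump chain. -/
theorem JumpChain.not_arithmeticalIn {C : ℕ → Set ℕ} (hC : JumpChain C) {W : Set ℕ}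
    (hW : ∀ i, TuringLE (C i) W) {Y : Set ℕ} (hY : TuringLE Y (C 0)) : ¬ ArithmeticalIn W Y := by
  intro h
  obtain ⟨j, hj⟩ := h.exists_turingLE
  exact not_turingLE_jump (C j) ((hC j).trans ((hW (j + 1)).trans (hj C hC hY)))

theorem turingLE_empty (C : Set ℕ) : TuringLE ∅ C := by
  obtain ⟨c, hc⟩ := exists_forall_eval_eq Nat.Partrec.zero
  refine turingLE_iff_exists_eval.2 ⟨c, (hc _).trans (funext fun n => ?_)⟩
  simp [charFun]
  rfl

/-! ### Cohen forcing for arithmetical formulas -/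

theorem getElem?_restrict {g : Set ℕ} {n i : ℕ} :
    (restrict g n)[i]? = some true ↔ i < n ∧ i ∈ g := by
  by_cases h : i < n <;> simp [restrict, h]

theorem restrict_isPrefix {g : Set ℕ} {m n : ℕ} (h : m ≤ n) :
    restrict g m <+: restrict g n := by
  obtain ⟨k, rfl⟩ := Nat.exists_eq_add_of_le h
  rw [restrict, restrict, List.range_add, List.map_append]
  exact List.prefix_append _ _

theorem getElem?_of_isPrefix {σ τ : List Bool} (h : σ <+: τ) {i : ℕ} {b : Bool}
    (hi : σ[i]? = some b) : τ[i]? = some b := by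
  obtain ⟨ρ, rfl⟩ := h
  rwa [List.getElem?_append_left (List.getElem?_eq_some_iff.1 hi).1]

/-- The strings that satisfy `P` or have no extension satisfying `P` form a dense set, even when `P`
itself is not dense. -/
theorem ArithGenericRel.decides {g Y : Set ℕ} (h : ArithGenericRel g Y)
    {P : List Bool → (Fin 1 → Set ℕ) → Prop} (hP : Arith P) :
    ∃ n, P (restrict g n) (fun _ => Y) ∨
      ∀ τ, restrict g n <+: τ → ¬ P τ (fun _ => Y) := by
  have hQ : Arith fun σ V => P σ V ∨ ∀ ρ, ¬ P (σ ++ ρ) V :=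
    hP.or (hP.comp (f := fun p : List Bool × List Bool => p.1 ++ p.2)
      (Primrec.list_append.comp .fst .snd).to_comp).not.all
  let D : Set (List Bool) := {σ | P σ (fun _ => Y) ∨ ∀ ρ, ¬ P (σ ++ ρ) (fun _ => Y)}
  have hD : ArithmeticalIn (Encodable.encode '' D) Y := by
    refine arithmeticalIn_iff.2 ⟨fun m V => ∃ σ, (P σ V ∨ ∀ ρ, ¬ P (σ ++ ρ) V) ∧
      Encodable.encode σ = m, ?_, fun m => Iff.rfl⟩
    exact Arith.ex ((hQ.comp Computable.snd).and
      (Arith.eq_nat (Computable.encode.comp Computable.snd) Computable.fst))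
  have hdense : DenseStrings D := by
    intro σ
    by_cases hσ : ∃ ρ, P (σ ++ ρ) (fun _ => Y)
    · obtain ⟨ρ, hρ⟩ := hσ
      exact ⟨σ ++ ρ, .inl hρ, List.prefix_append _ _⟩
    · exact ⟨σ, .inr (not_exists.1 hσ), List.prefix_refl _⟩
  obtain ⟨n, hn | hn⟩ := h D hD hdense
  · refine ⟨n, hn.imp_right fun h => ?_⟩
    rintro _ ⟨ρ, rfl⟩
    exact h ρ
  · obtain ⟨τ, hτ, h⟩ := hdense (restrict g n)
    exact absurd hτ (hn τ h)

/-- The string `σ` forces `φ`, where the set variable `0` denotes `Y` and the other set variables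
denote the generic set. -/
def Form.forces (Y : Set ℕ) : {n k : ℕ} → Form n k → List Bool → (Fin n → ℕ) → Prop
  | _, _, .eq s t, _, v => s.nval v = t.nval v
  | _, _, .lt s t, _, v => s.nval v < t.nval v
  | _, _, .mem t X, σ, v => if X.val = 0 then t.nval v ∈ Y else σ[t.nval v]? = some true
  | _, _, .neg φ, σ, v => ∀ ρ, ¬ φ.forces Y (σ ++ ρ) v
  | _, _, .and φ ψ, σ, v => φ.forces Y σ v ∧ ψ.forces Y σ v
  | _, _, .allN φ, σ, v => ∀ a : ℕ, φ.forces Y σ (SOA.snoc v a)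
  | _, _, .allS _, _, _ => True

theorem Form.forces_mono (Y : Set ℕ) {n k : ℕ} (φ : Form n k) {σ τ : List Bool} (h : σ <+: τ)
    {v : Fin n → ℕ} (hφ : φ.forces Y σ v) : φ.forces Y τ v := by
  induction φ with
  | eq s t => exact hφ
  | lt s t => exact hφ
  | mem t X =>
    simp only [Form.forces] at hφ ⊢
    split_ifs at hφ ⊢ with hX
    · exact hφ
    · exact getElem?_of_isPrefix h hφ
  | neg φ ih =>
    obtain ⟨ρ, rfl⟩ := h
    intro ρ'
    rw [List.append_assoc]
    exact hφ _
  | and φ ψ h1 h2 => exact ⟨h1 hφ.1, h2 hφ.2⟩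
  | allN φ ih => exact fun a => ih (hφ a)
  | allS φ ih => trivial

/-- If `φ` is not forced by `σ`, then some extension of `σ` forces the negation of `φ`. -/
theorem Form.exists_forall_not_forces (Y : Set ℕ) {n k : ℕ} (φ : Form n k) {σ : List Bool}
    {v : Fin n → ℕ} (h : ¬ φ.forces Y σ v) : ∃ τ, ∀ ρ, ¬ φ.forces Y (σ ++ τ ++ ρ) v := by
  induction φ with
  | eq s t => exact ⟨[], fun _ => h⟩
  | lt s t => exact ⟨[], fun _ => h⟩
  | mem t X =>
    simp only [Form.forces] at h ⊢
    split_ifs at h ⊢ with hX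
    · exact ⟨[], fun _ => h⟩
    -- Enough zeros are appended to reach position `t`. The bit there is then fixed as not `true`,
    -- unless it was already `true` in `σ`.
    · refine ⟨List.replicate (t.nval v + 1) false, fun ρ h' => h ?_⟩
      rw [List.append_assoc, List.getElem?_append] at h'
      split_ifs at h' with h1
      · exact h'
      · rw [List.getElem?_append_left (by simp), List.getElem?_replicate] at h'
        split_ifs at h'
        simp at h'
  | neg φ ih =>
    obtain ⟨τ, hτ⟩ := not_forall.1 h
    exact ⟨τ, fun ρ hρ => hρ [] (φ.forces_mono Y (by simp) (not_not.1 hτ))⟩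
  | and φ ψ h1 h2 =>
    rcases not_and_or.1 h with h | h
    · obtain ⟨τ, hτ⟩ := h1 h
      exact ⟨τ, fun ρ hρ => hτ ρ hρ.1⟩
    · obtain ⟨τ, hτ⟩ := h2 h
      exact ⟨τ, fun ρ hρ => hτ ρ hρ.2⟩
  | allN φ ih =>
    obtain ⟨a, ha⟩ := not_forall.1 h
    obtain ⟨τ, hτ⟩ := ih ha
    exact ⟨τ, fun ρ hρ => hτ ρ (hρ a)⟩
  | allS φ ih => exact absurd trivial h

theorem computable_append {α : Type} [Primcodable α] :
    Computable fun p : (List Bool × α) × List Bool => (p.1.1 ++ p.2, p.1.2) :=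
  ((Primrec.list_append.comp (Primrec.fst.comp .fst) .snd).pair (Primrec.snd.comp .fst)).to_comp

/-- The quantifier over extensions in the negation clause ranges over finite strings, so it is a
number quantifier. -/
theorem Form.arith_forces {n k : ℕ} (φ : Form n k) (h : φ.IsArithmetical) :
    Arith fun (p : List Bool × (Fin n → ℕ)) (V : Fin 1 → Set ℕ) =>
      φ.forces (V 0) p.1 p.2 := by
  induction φ with
  | eq s t =>
    exact Arith.eq_nat (s.primrec_nval.comp .snd).to_comp (t.primrec_nval.comp .snd).to_comp
  | lt s t =>
    exact Arith.lt_nat (s.primrec_nval.comp .snd).to_comp (t.primrec_nval.comp .snd).to_comp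
  | mem t X =>
    by_cases hX : X.val = 0
    · simp only [Form.forces, hX, if_true]
      exact Arith.mem 0 (t.primrec_nval.comp .snd).to_comp
    · simp only [Form.forces, hX, if_false]
      exact Arith.of_primrecPred (Primrec.eq.comp
        (Primrec.list_getElem?.comp .fst (t.primrec_nval.comp .snd)) (.const _))
  | neg φ ih => exact ((ih h).comp computable_append).not.all
  | and φ ψ h1 h2 => exact (h1 h.1).and (h2 h.2)
  | allN φ ih =>
    exact ((ih h).comp (f := fun p : (List Bool × (Fin _ → ℕ)) × ℕ => (p.1.1, SOA.snoc p.1.2 p.2))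
      ((Primrec.fst.comp .fst).pair (primrec_snoc.comp ((Primrec.snd.comp .fst).pair .snd))).to_comp
      ).all
  | allS φ ih => exact h.elim

/-- The truth lemma. Genericity is used for negations and for universal quantifiers, where a
condition has to settle what holds of the generic set. -/
theorem Form.sat_iff_forces {g Y : Set ℕ} (hg : ArithGenericRel g Y) {n k : ℕ} (φ : Form n k)
    (h : φ.IsArithmetical) {V : Fin k → Set ℕ} (hV : ∀ X, V X = if X.val = 0 then Y else g)
    (v : Fin n → ℕ) : φ.sat Set.univ v V ↔ ∃ m, φ.forces Y (restrict g m) v := by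
  induction φ with
  | eq s t => exact ⟨fun h => ⟨0, h⟩, fun ⟨_, h⟩ => h⟩
  | lt s t => exact ⟨fun h => ⟨0, h⟩, fun ⟨_, h⟩ => h⟩
  | mem t X =>
    simp only [Form.forces, Form.sat, hV]
    split_ifs
    · simp
    · simp only [getElem?_restrict]
      exact ⟨fun h => ⟨_, Nat.lt_succ_self _, h⟩, fun ⟨_, _, h⟩ => h⟩
  | neg φ ih =>
    rw [sat_neg, ih h hV]
    constructor
    · intro hn
      have hP : Arith fun (σ : List Bool) (V : Fin 1 → Set ℕ) => φ.forces (V 0) σ v :=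
        (φ.arith_forces h).comp (f := fun σ : List Bool => (σ, v))
          (Primrec.id.pair (.const v)).to_comp
      obtain ⟨m, hm | hm⟩ := hg.decides hP
      · exact absurd ⟨m, hm⟩ hn
      · exact ⟨m, fun ρ => hm _ (List.prefix_append _ _)⟩
    · rintro ⟨m, hm⟩ ⟨m', hm'⟩
      obtain ⟨ρ, hρ⟩ := restrict_isPrefix (g := g) (le_max_left m m')
      exact hm ρ (hρ ▸ φ.forces_mono Y (restrict_isPrefix (le_max_right m m')) hm')
  | and φ ψ h1 h2 =>
    rw [sat_and, h1 h.1 hV, h2 h.2 hV]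
    constructor
    · rintro ⟨⟨m, hm⟩, ⟨m', hm'⟩⟩
      exact ⟨max m m', φ.forces_mono Y (restrict_isPrefix (le_max_left ..)) hm,
        ψ.forces_mono Y (restrict_isPrefix (le_max_right ..)) hm'⟩
    · rintro ⟨m, hm⟩
      exact ⟨⟨m, hm.1⟩, ⟨m, hm.2⟩⟩
  | allN φ ih =>
    simp only [sat_allN, ih h hV]
    constructor
    · intro hn
      -- Decide whether some instance is refuted. A refuting segment of `g` contradicts the truth of
      -- all instances. If no extension of a segment refutes any, that segment forces all instances
      -- at once, because an unforced instance could be refuted by an extension.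
      have hP : Arith fun (σ : List Bool) (V : Fin 1 → Set ℕ) =>
          ∃ a : ℕ, ∀ ρ, ¬ φ.forces (V 0) (σ ++ ρ) (SOA.snoc v a) := by
        have hc : Computable fun p : List Bool × ℕ => (p.1, SOA.snoc v p.2) :=
          (Primrec.fst.pair (primrec_snoc.comp ((Primrec.const v).pair .snd))).to_comp
        exact ((((φ.arith_forces h).comp computable_append).not.all).comp hc).ex
      obtain ⟨m, ⟨a, hm⟩ | hm⟩ := hg.decides hP
      · obtain ⟨m', hm'⟩ := hn a
        obtain ⟨ρ, hρ⟩ := restrict_isPrefix (g := g) (le_max_left m m')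
        exact absurd (φ.forces_mono Y (restrict_isPrefix (le_max_right m m')) hm') (hρ ▸ hm ρ)
      · refine ⟨m, fun a => ?_⟩
        by_contra ha
        obtain ⟨τ, hτ⟩ := φ.exists_forall_not_forces Y ha
        exact hm _ (List.prefix_append _ τ) ⟨a, hτ⟩
    · rintro ⟨m, hm⟩ a
      exact ⟨m, hm a⟩
  | allS φ ih => exact h.elim

/-- The forcing theorem: an arithmetical predicate of `Y` and the generic set has a forcing
relation that is arithmetical in `Y`. -/
theorem Arith.exists_forcing {α : Type} [Primcodable α] {P : α → (Fin 2 → Set ℕ) → Prop}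
    (hP : Arith P) : ∃ F : List Bool × α → (Fin 1 → Set ℕ) → Prop, Arith F ∧
      (∀ σ τ a V, σ <+: τ → F (σ, a) V → F (τ, a) V) ∧
      ∀ g Y, ArithGenericRel g Y → ∀ a,
        P a ![Y, g] ↔ ∃ n, F (restrict g n, a) fun _ => Y := by
  obtain ⟨φ, hφ, hP⟩ := hP
  refine ⟨fun p V => φ.forces (V 0) p.1 fun _ => Encodable.encode p.2,
    (φ.arith_forces hφ).comp (f := fun p : List Bool × α => (p.1, fun _ => Encodable.encode p.2))
      (Primrec.fst.pair (Primrec.fin_curry.2 ((Primrec.encode.comp .snd).comp .fst).to₂)).to_comp,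
    fun σ τ a V h => φ.forces_mono _ h, fun g Y hg a => ?_⟩
  rw [hP]
  refine φ.sat_iff_forces hg hφ (fun X => ?_) _
  fin_cases X <;> rfl

/-! ### Existence of generic sets -/

theorem exists_restrict_mem (D : ℕ → Set (List Bool)) (hD : ∀ n, DenseStrings (D n))
    (σ : List Bool) : ∃ g : Set ℕ, restrict g σ.length = σ ∧ ∀ n, ∃ m, restrict g m ∈ D n := by
  choose f hfD hf using fun n τ => hD n τ
  let s : ℕ → List Bool := fun n => Nat.rec σ f n
  have hs : ∀ n, s n <+: s (n + 1) := fun n => hf n (s n)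
  have hmono : ∀ {m n}, m ≤ n → s m <+: s n := fun {m n} h => by
    induction n, h using Nat.le_induction with
    | base => exact List.prefix_refl _
    | succ n _ ih => exact ih.trans (hs n)
  let g : Set ℕ := {i | ∃ n, (s n)[i]? = some true}
  have hg : ∀ n, restrict g (s n).length = s n := by
    intro n
    refine List.ext_getElem (by simp [restrict]) fun i h1 h2 => ?_
    have key : (restrict g (s n).length)[i]? = some true ↔ (s n)[i]? = some true := by
      rw [getElem?_restrict]
      refine ⟨?_, fun h => ⟨h2, n, h⟩⟩
      rintro ⟨-, m, hm⟩
      rw [← getElem?_of_isPrefix (hmono (le_max_left m n)) hm]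
      have hi := List.getElem?_eq_getElem h2
      rw [hi, getElem?_of_isPrefix (hmono (le_max_right m n)) hi]
    rw [List.getElem?_eq_getElem h1, List.getElem?_eq_getElem h2, Option.some_inj,
      Option.some_inj] at key
    exact Bool.eq_iff_iff.2 key
  exact ⟨g, hg 0, fun n => ⟨(s (n + 1)).length, by rw [hg (n + 1)]; exact hfD n (s n)⟩⟩

/-- Only countably many dense sets must be met. The prescribed beginning `σ` makes it possible to
realize any forcing condition by a generic set. -/
theorem exists_arithGenericRel (Y : Set ℕ) (σ : List Bool) :
    ∃ g, restrict g σ.length = σ ∧ ArithGenericRel g Y := by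
  have hc : {D : Set (List Bool) | ArithmeticalIn (Encodable.encode '' D) Y ∧
      DenseStrings D}.Countable := by
    refine Set.Countable.mono (fun D hD => hD.1 : _ ⊆ (Set.image (Encodable.encode)) ⁻¹'
      {A | ArithmeticalIn A Y}) ?_
    exact (countable_arithmeticalIn Y).preimage (Set.image_injective.2 Encodable.encode_injective)
  have hne : {D : Set (List Bool) | ArithmeticalIn (Encodable.encode '' D) Y ∧
      DenseStrings D}.Nonempty := by
    refine ⟨Set.univ, ?_, fun σ => ⟨σ, trivial, List.prefix_refl _⟩⟩
    refine arithmeticalIn_iff.2 ⟨fun m V => ∃ σ : List Bool, Encodable.encode σ = m,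
      Arith.ex (Arith.eq_nat (Computable.encode.comp .snd) .fst), fun m => by simp⟩
  obtain ⟨D, hD⟩ := hc.exists_eq_range hne
  have hD' : ∀ n, ArithmeticalIn (Encodable.encode '' D n) Y ∧ DenseStrings (D n) := fun n => by
    have : D n ∈ Set.range D := ⟨n, rfl⟩
    rwa [← hD] at this
  obtain ⟨g, hσ, hg⟩ := exists_restrict_mem D (fun n => (hD' n).2) σ
  refine ⟨g, hσ, fun E hE hE' => ?_⟩
  obtain ⟨n, rfl⟩ : E ∈ Set.range D := hD ▸ ⟨hE, hE'⟩
  obtain ⟨m, hm⟩ := hg n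
  exact ⟨m, .inl hm⟩

theorem exists_iteratedGeneric : ∃ g, IteratedGeneric g := by
  choose f _ hf using fun Y => exists_arithGenericRel Y []
  let J : ℕ → Set ℕ := fun n => Nat.rec (f ∅) (fun _ X => join X (f X)) n
  let g : ℕ → Set ℕ := fun n => Nat.casesOn n (f ∅) fun n => f (J n)
  have hJ : ∀ n, joinUpTo g n = J n := fun n => by
    induction n with
    | zero => rfl
    | succ n ih => rw [joinUpTo, ih]
  exact ⟨g, hf ∅, fun n => hJ n ▸ hf (J n)⟩

/-! ### Sets arithmetical in a generic extension -/

theorem ArithmeticalIn.exists_arith_join {A Y g : Set ℕ} (h : ArithmeticalIn A (join Y g)) :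
    ∃ R : ℕ → (Fin 2 → Set ℕ) → Prop, Arith R ∧ A = {m | R m ![Y, g]} := by
  obtain ⟨P, hP, h⟩ := arithmeticalIn_iff.1 h
  have hj : Arith fun (p : ℕ × ℕ) (V : Fin 2 → Set ℕ) => p.2 ∈ join (V 0) (V 1) := by
    have h2 : Computable fun q : (ℕ × ℕ) × ℕ => 2 * q.2 :=
      (Primrec.nat_mul.comp (.const 2) .snd).to_comp
    exact ((Arith.mem 0 Computable.snd).and
        (Arith.eq_nat (Computable.snd.comp Computable.fst) h2)).ex.or
      ((Arith.mem 1 Computable.snd).and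
        (Arith.eq_nat (Computable.snd.comp Computable.fst) (Computable.succ.comp h2))).ex
  exact ⟨_, hP.subst (Q := fun _ p V => p.2 ∈ join (V 0) (V 1)) fun _ => hj, Set.ext h⟩

/-- If `W` is the only set with an arithmetical property and `W` is arithmetical in `Y` and a
generic set, then `W` is arithmetical in `Y`. -/
theorem ArithmeticalIn.of_join_of_unique {g Y W : Set ℕ} (hg : ArithGenericRel g Y)
    {Ψ : Unit → (Fin 1 → Set ℕ) → Prop} (hΨ : Arith Ψ) (hW : Ψ () fun _ => W)
    (hu : ∀ W', Ψ () (fun _ => W') → W' = W) (h : ArithmeticalIn W (join Y g)) :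
    ArithmeticalIn W Y := by
  obtain ⟨R, hR, hWR⟩ := h.exists_arith_join
  have hR' : ∀ m, m ∈ W ↔ R m ![Y, g] := fun m => by rw [hWR]; rfl
  obtain ⟨F, -, hFm, hF⟩ := (hΨ.subst (Q := fun _ p => R p.2)
    fun _ => hR.comp Computable.snd).exists_forcing
  obtain ⟨G, hGa, hGm, hG⟩ := hR.exists_forcing
  -- An initial segment of `g` forces that the set named by `R` has the property `Ψ`. A number is
  -- then in `W` iff an extension of that segment forces it into the named set.
  obtain ⟨n, hn⟩ := (hF g Y hg ()).1 (by rw [← hWR]; exact hW)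
  refine arithmeticalIn_iff.2 ⟨fun m V => ∃ ρ, G (restrict g n ++ ρ, m) V, ?_, fun m => ?_⟩
  · exact (hGa.comp (f := fun p : ℕ × List Bool => (restrict g n ++ p.2, p.1))
      ((Primrec.list_append.comp (.const _) .snd).pair .fst).to_comp).ex
  · constructor
    · intro hm
      obtain ⟨n', hn'⟩ := (hG g Y hg m).1 ((hR' m).1 hm)
      obtain ⟨ρ, hρ⟩ := restrict_isPrefix (g := g) (le_max_left n n')
      exact ⟨ρ, hρ ▸ hGm _ _ _ _ (restrict_isPrefix (le_max_right n n')) hn'⟩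
    · rintro ⟨ρ, hρ⟩
      -- The named set evaluated at a generic `g'` through the extension also satisfies `Ψ`, so by
      -- uniqueness it equals `W`.
      obtain ⟨g', hσ, hg'⟩ := exists_arithGenericRel Y (restrict g n ++ ρ)
      have h1 := (hF g' Y hg' ()).2 ⟨_, by rw [hσ]; exact hFm _ _ _ _ (List.prefix_append _ _) hn⟩
      rw [← hu _ h1]
      exact (hG g' Y hg' m).2 ⟨_, by rw [hσ]; exact hρ⟩

/-- Were `g` arithmetical in `Y`, so would be the set of strings that disagree with `g` somewhere.
No initial segment of `g` is in it, yet each has an extension in it, by appending the wrong bit. -/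
theorem ArithGenericRel.not_arithmeticalIn {g Y : Set ℕ} (hg : ArithGenericRel g Y) :
    ¬ ArithmeticalIn g Y := by
  intro h
  obtain ⟨P, hP, h⟩ := arithmeticalIn_iff.1 h
  have hD : Arith fun (σ : List Bool) V => ∃ i, i < σ.length ∧ ¬ (σ[i]? = some true ↔ P i V) :=
    ((Arith.lt_nat Computable.snd (Computable.list_length.comp .fst)).and
      ((Arith.of_primrecPred (Primrec.eq.comp
        (Primrec.list_getElem?.comp .fst .snd) (.const (some true)))).iff
          (hP.comp Computable.snd)).not).ex
  obtain ⟨n, ⟨i, hi, hn⟩ | hn⟩ := hg.decides hD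
  · rw [getElem?_restrict, ← h i] at hn
    simp only [restrict, List.length_map, List.length_range] at hi
    exact hn ⟨fun h => h.2, fun h => ⟨hi, h⟩⟩
  · classical
    refine hn (restrict g n ++ [decide (n ∉ g)]) (List.prefix_append _ _) ⟨n, ?_, ?_⟩
    · simp [restrict]
    · rw [← h n]
      have hl : (restrict g n).length = n := by simp [restrict]
      rw [List.getElem?_append_right (by omega), hl]
      by_cases hng : n ∈ g <;> simp [hng]

/-! ### Perfect subtrees -/

/-- `f` is the graph of a function. -/
def IsFunctionGraph (f : Set ℕ) : Prop :=
  ∀ x, ∃ y, Nat.pair x y ∈ f ∧ ∀ z, Nat.pair x z ∈ f → z = y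

/-- `s` is an initial segment of the function with graph `f`. -/
def InitSeg (s : List ℕ) (f : Set ℕ) : Prop :=
  ∀ i, i < s.length → Nat.pair i (s.getD i 0) ∈ f

theorem IsFunctionGraph.exists_eq {f : Set ℕ} (hf : IsFunctionGraph f) :
    ∃ F : ℕ → ℕ, (∀ x y, Nat.pair x y ∈ f ↔ y = F x) ∧
      ∀ s, InitSeg s f ↔ s = (List.range s.length).map F := by
  choose F hF hF' using hf
  have h : ∀ x y, Nat.pair x y ∈ f ↔ y = F x := fun x y => ⟨hF' x y, fun h => h ▸ hF x⟩
  refine ⟨F, h, fun s =>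
    ⟨fun hs => List.ext_getElem (by simp) fun i h1 h2 => ?_, fun hs i hi => ?_⟩⟩
  · have := hs i h1
    rw [h, List.getD_eq_getElem _ _ h1] at this
    simpa using this
  · rw [h, hs, List.getD_eq_getElem _ _ (by simpa using hi)]
    simp

theorem InitSeg.of_isPrefix {s t : List ℕ} {f : Set ℕ} (ht : InitSeg t f) (h : s <+: t) :
    InitSeg s f := by
  obtain ⟨r, rfl⟩ := h
  intro i hi
  have := ht i (by simp; omega)
  rwa [List.getD_append _ _ _ _ hi] at this

theorem InitSeg.isPrefix {s t : List ℕ} {f : Set ℕ} (hf : IsFunctionGraph f) (hs : InitSeg s f)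
    (ht : InitSeg t f) (h : s.length ≤ t.length) : s <+: t := by
  obtain ⟨F, -, hF⟩ := hf.exists_eq
  obtain ⟨k, hk⟩ := Nat.exists_eq_add_of_le h
  rw [(hF s).1 hs, (hF t).1 ht, hk, List.range_add, List.map_append]
  exact List.prefix_append _ _

theorem InitSeg.exists_upper {s t : List ℕ} {f : Set ℕ} (hf : IsFunctionGraph f)
    (hs : InitSeg s f) (ht : InitSeg t f) : ∃ u, InitSeg u f ∧ s <+: u ∧ t <+: u := by
  rcases le_total s.length t.length with h | h
  · exact ⟨t, ht, hs.isPrefix hf ht h, List.prefix_refl _⟩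
  · exact ⟨s, hs, List.prefix_refl _, ht.isPrefix hf hs h⟩

theorem IsFunctionGraph.exists_initSeg {f : Set ℕ} (hf : IsFunctionGraph f) (n : ℕ) :
    ∃ s, InitSeg s f ∧ s.length = n := by
  obtain ⟨F, -, hF⟩ := hf.exists_eq
  exact ⟨(List.range n).map F, (hF _).2 (by simp), by simp⟩

section

variable {α : Type} [Primcodable α] {k : ℕ}

theorem Arith.initSeg {R : ℕ → (Fin (k + 1) → Set ℕ) → Prop} (hR : Arith R) :
    Arith fun (s : List ℕ) V => InitSeg s {m | R m V} :=
  ((Arith.lt_nat Computable.snd (Computable.list_length.comp .fst)).imp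
    (hR.comp (f := fun p : List ℕ × ℕ => Nat.pair p.2 (p.1.getD p.2 0))
      (Primrec₂.natPair.comp .snd ((Primrec.list_getD 0).comp .fst .snd)).to_comp)).all

theorem Arith.isFunctionGraph {R : ℕ → (Fin (k + 1) → Set ℕ) → Prop} (hR : Arith R) :
    Arith fun (_ : Unit) V => IsFunctionGraph {m | R m V} := by
  have h1 : Computable fun p : (Unit × ℕ) × ℕ => Nat.pair p.1.2 p.2 :=
    (Primrec₂.natPair.comp (Primrec.snd.comp .fst) .snd).to_comp
  have h2 : Computable fun p : ((Unit × ℕ) × ℕ) × ℕ => Nat.pair p.1.1.2 p.2 :=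
    (Primrec₂.natPair.comp (Primrec.snd.comp (Primrec.fst.comp .fst)) .snd).to_comp
  exact ((hR.comp h1).and ((hR.comp h2).imp
    (Arith.eq_nat Computable.snd (Computable.snd.comp .fst))).all).ex.all

theorem Arith.isPrefix {f g : α → List ℕ} (hf : Computable f) (hg : Computable g) :
    Arith fun a (_ : Fin (k + 1) → Set ℕ) => f a <+: g a := by
  have h : Arith fun (p : List ℕ × List ℕ) (_ : Fin (k + 1) → Set ℕ) => ∃ r, p.1 ++ r = p.2 :=
    (Arith.of_primrecPred (Primrec.eq.comp
      (Primrec.list_append.comp (Primrec.fst.comp .fst) .snd) (Primrec.snd.comp .fst))).ex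
  exact h.comp (hf.pair hg)

end

/-- A tree that is arithmetical in `Y` has a perfect subtree arithmetical in `Y` if it has a path
that is arithmetical in `Y` and a generic set, but not in `Y`. -/
theorem exists_perfect_subtree {g Y T f : Set ℕ} (hg : ArithGenericRel g Y)
    (hT : ArithmeticalIn T Y) (hf : ArithmeticalIn f (join Y g)) (hfun : IsFunctionGraph f)
    (hpath : ∀ s, InitSeg s f → Encodable.encode s ∈ T) (hfY : ¬ ArithmeticalIn f Y) :
    ∃ S : Set ℕ, ArithmeticalIn S Y ∧ (∃ s : List ℕ, Encodable.encode s ∈ S) ∧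
      (∀ s t : List ℕ, s <+: t → Encodable.encode t ∈ S → Encodable.encode s ∈ S) ∧
      (∀ s : List ℕ, Encodable.encode s ∈ S → Encodable.encode s ∈ T) ∧
      ∀ s : List ℕ, Encodable.encode s ∈ S → ∃ t u : List ℕ, Encodable.encode t ∈ S ∧
        Encodable.encode u ∈ S ∧ s <+: t ∧ s <+: u ∧ ¬ t <+: u ∧ ¬ u <+: t := by
  obtain ⟨R, hR, rfl⟩ := hf.exists_arith_join
  obtain ⟨Q, hQ, hTQ⟩ := arithmeticalIn_iff.1 hT
  have hQ' : Arith fun (m : ℕ) (V : Fin 2 → Set ℕ) => Q m fun _ => V 0 := by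
    simpa using hQ.subst (Q := fun (_ : Fin 1) p (V : Fin 2 → Set ℕ) => p.2 ∈ V 0)
      fun _ => Arith.mem 0 Computable.snd
  have hΨ : Arith fun (_ : Unit) (V : Fin 2 → Set ℕ) => IsFunctionGraph {m | R m V} ∧
      ∀ s, InitSeg s {m | R m V} → Q (Encodable.encode s) fun _ => V 0 :=
    hR.isFunctionGraph.and ((hR.initSeg.comp Computable.snd).imp
      (hQ'.comp (Computable.encode.comp .snd))).all
  -- `F` is the forcing relation for "the named set is a path through `T`", and `G` the one for "`s`
  -- is a segment of the named path".
  obtain ⟨F, -, hFm, hF⟩ := hΨ.exists_forcing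
  obtain ⟨G, hGa, hGm, hG⟩ := hR.initSeg.exists_forcing
  -- Below `q`, no two extensions force incompatible segments of the named path.
  have hB : Arith fun (q : List Bool) V => ¬ ∃ r : (List Bool × List Bool) × List ℕ × List ℕ,
      G (q ++ r.1.1, r.2.1) V ∧ G (q ++ r.1.2, r.2.2) V ∧
        ¬ r.2.1 <+: r.2.2 ∧ ¬ r.2.2 <+: r.2.1 := by
    let X := List Bool × (List Bool × List Bool) × List ℕ × List ℕ
    have ht : Primrec fun p : X => p.2.2.1 := Primrec.fst.comp (Primrec.snd.comp .snd)
    have hu : Primrec fun p : X => p.2.2.2 := Primrec.snd.comp (Primrec.snd.comp .snd)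
    exact ((hGa.comp (f := fun p : X => (p.1 ++ p.2.1.1, p.2.2.1))
        ((Primrec.list_append.comp .fst (Primrec.fst.comp (Primrec.fst.comp .snd))).pair
          ht).to_comp).and ((hGa.comp (f := fun p : X => (p.1 ++ p.2.1.2, p.2.2.2))
        ((Primrec.list_append.comp .fst (Primrec.snd.comp (Primrec.fst.comp .snd))).pair
          hu).to_comp).and
      ((Arith.isPrefix ht.to_comp hu.to_comp).not.and
        (Arith.isPrefix hu.to_comp ht.to_comp).not))).ex.not
  obtain ⟨n₁, hn₁⟩ := (hF g Y hg ()).1 ⟨hfun, fun s hs => (hTQ _).1 (hpath s hs)⟩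
  obtain ⟨n₂, hn₂ | hn₂⟩ := hg.decides hB
  · -- an initial segment of `g` decides the whole path
    refine absurd (arithmeticalIn_iff.2 ⟨fun m V => ∃ r : List Bool × List ℕ,
      G (restrict g n₂ ++ r.1, r.2) V ∧ m.unpair.1 < r.2.length ∧
        r.2.getD m.unpair.1 0 = m.unpair.2, ?_, fun m => ?_⟩) hfY
    · have hx : Primrec fun p : ℕ × List Bool × List ℕ => p.1.unpair.1 :=
        Primrec.fst.comp (Primrec.unpair.comp .fst)
      have hs : Primrec fun p : ℕ × List Bool × List ℕ => p.2.2 := Primrec.snd.comp .snd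
      exact ((hGa.comp (f := fun p : ℕ × List Bool × List ℕ => (restrict g n₂ ++ p.2.1, p.2.2))
        ((Primrec.list_append.comp (.const _) (Primrec.fst.comp .snd)).pair hs).to_comp).and
        ((Arith.lt_nat hx.to_comp (Primrec.list_length.comp hs).to_comp).and
          (Arith.eq_nat ((Primrec.list_getD 0).comp hs hx).to_comp
            (Primrec.snd.comp (Primrec.unpair.comp .fst)).to_comp))).ex
    -- True segments of every length are forced below the deciding condition. Any other forced
    -- segment is comparable with the true one of equal length, hence equal to it, so the forced
    -- segments define `f` from `Y`.
    · have hseg : ∀ n, ∃ ρ s, G (restrict g n₂ ++ ρ, s) (fun _ => Y) ∧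
          InitSeg s {m | R m ![Y, g]} ∧ s.length = n := fun n => by
        obtain ⟨s, hs, hl⟩ := hfun.exists_initSeg n
        obtain ⟨n', hn'⟩ := (hG g Y hg s).1 hs
        obtain ⟨ρ, hρ⟩ := restrict_isPrefix (g := g) (le_max_left n₂ n')
        exact ⟨ρ, s, hρ ▸ hGm _ _ _ _ (restrict_isPrefix (le_max_right n₂ n')) hn', hs, hl⟩
      obtain ⟨φ, hφ, hφ'⟩ := hfun.exists_eq
      constructor
      · intro hm
        obtain ⟨ρ, s, h1, h2, h3⟩ := hseg (m.unpair.1 + 1)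
        have hlt : m.unpair.1 < s.length := by omega
        refine ⟨(ρ, s), h1, hlt, ?_⟩
        exact ((hφ _ _).1 (h2 m.unpair.1 hlt)).trans
          ((hφ m.unpair.1 m.unpair.2).1 (by rwa [Nat.pair_unpair])).symm
      · rintro ⟨⟨ρ, t⟩, h1, h2, h3⟩
        obtain ⟨ρ', s, h1', h2', h3'⟩ := hseg t.length
        have hst : t = s := by
          by_contra hne
          refine hn₂ ⟨((ρ, ρ'), t, s), h1, h1', fun h => hne ?_, fun h => hne ?_⟩
          · exact h.eq_of_length h3'.symm
          · exact (h.eq_of_length h3').symm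
        rw [← Nat.pair_unpair m, ← h3, hst]
        exact h2' _ (hst ▸ h2)
  -- In the remaining case `p` forces a path through `T`, and every extension of `p` can force
  -- incompatible segments.
  · obtain ⟨p, hp1, hp2⟩ : ∃ p, F (p, ()) (fun _ => Y) ∧ restrict g n₂ <+: p :=
      ⟨_, hFm _ _ _ _ (restrict_isPrefix (le_max_left n₁ n₂)) hn₁,
        restrict_isPrefix (le_max_right n₁ n₂)⟩
    -- Each extension of `p` is realized by a generic `g'`, whose named path runs through `T`, has
    -- all segments forced so far, and has only segments forced by extensions of `p`.
    have key : ∀ ρ, ∃ f : Set ℕ, IsFunctionGraph f ∧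
        (∀ s, InitSeg s f → Encodable.encode s ∈ T) ∧
        (∀ s, G (p ++ ρ, s) (fun _ => Y) → InitSeg s f) ∧
        ∀ s, InitSeg s f → ∃ ρ', G (p ++ ρ', s) fun _ => Y := by
      intro ρ
      obtain ⟨g', hσ, hg'⟩ := exists_arithGenericRel Y (p ++ ρ)
      obtain ⟨h1, h2⟩ := (hF g' Y hg' ()).2
        ⟨_, by rw [hσ]; exact hFm _ _ _ _ (List.prefix_append _ _) hp1⟩
      refine ⟨{m | R m ![Y, g']}, h1, fun s hs => (hTQ _).2 (h2 s hs),
        fun s hs => (hG g' Y hg' s).2 ⟨_, by rw [hσ]; exact hs⟩, fun s hs => ?_⟩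
      obtain ⟨n, hn⟩ := (hG g' Y hg' s).1 hs
      obtain ⟨ρ', hρ'⟩ := restrict_isPrefix (g := g') (le_max_left (p ++ ρ).length n)
      refine ⟨ρ ++ ρ', ?_⟩
      rw [← List.append_assoc, ← hσ, List.length_append, ← List.length_append, hρ']
      exact hGm _ _ _ _ (restrict_isPrefix (le_max_right _ _)) hn
    let S : Set ℕ := {m | ∃ r : List Bool × List ℕ, G (p ++ r.1, r.2) (fun _ => Y) ∧
      Encodable.encode r.2 = m}
    have hS : ∀ s : List ℕ, Encodable.encode s ∈ S ↔ ∃ ρ, G (p ++ ρ, s) fun _ => Y := by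
      intro s
      constructor
      · rintro ⟨⟨ρ, t⟩, h1, h2⟩
        exact ⟨ρ, Encodable.encode_injective h2 ▸ h1⟩
      · rintro ⟨ρ, h⟩
        exact ⟨(ρ, s), h, rfl⟩
    refine ⟨S, ?_, ?_, ?_, ?_, ?_⟩
    · refine arithmeticalIn_iff.2 ⟨fun m V => ∃ r : List Bool × List ℕ, G (p ++ r.1, r.2) V ∧
        Encodable.encode r.2 = m, ?_, fun m => Iff.rfl⟩
      have hs : Primrec fun p : ℕ × List Bool × List ℕ => p.2.2 := Primrec.snd.comp .snd
      exact ((hGa.comp (f := fun q : ℕ × List Bool × List ℕ => (p ++ q.2.1, q.2.2))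
        ((Primrec.list_append.comp (.const _) (Primrec.fst.comp .snd)).pair hs).to_comp).and
        (Arith.eq_nat (Primrec.encode.comp hs).to_comp Computable.fst)).ex
    · obtain ⟨f, -, -, -, h⟩ := key []
      exact ⟨[], (hS _).2 (h [] fun i hi => absurd hi (Nat.not_lt_zero _))⟩
    · intro s t hst ht
      obtain ⟨ρ, hρ⟩ := (hS t).1 ht
      obtain ⟨f, -, -, h1, h2⟩ := key ρ
      exact (hS s).2 (h2 s ((h1 t hρ).of_isPrefix hst))
    · intro s hs
      obtain ⟨ρ, hρ⟩ := (hS s).1 hs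
      obtain ⟨f, -, h1, h2, -⟩ := key ρ
      exact h1 s (h2 s hρ)
    · intro s hs
      obtain ⟨ρ, hρ⟩ := (hS s).1 hs
      have hsplit := hn₂ (p ++ ρ) (hp2.trans (List.prefix_append _ _))
      obtain ⟨⟨⟨ρ₁, ρ₂⟩, t, u⟩, ht, hu, htu, hut⟩ := not_not.1 hsplit
      -- The split segments need not extend `s`, but each lies with `s` on a common path. The longer
      -- of the two on that path belongs to `S` and extends both.
      have hup : ∀ ρ' t, G (p ++ ρ ++ ρ', t) (fun _ => Y) →
          ∃ t', Encodable.encode t' ∈ S ∧ s <+: t' ∧ t <+: t' := by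
        intro ρ' t ht
        obtain ⟨f, hf, -, h1, h2⟩ := key (ρ ++ ρ')
        rw [← List.append_assoc] at h1
        obtain ⟨t', ht', h3, h4⟩ := (h1 s (hGm _ _ _ _ (List.prefix_append _ _) hρ)).exists_upper
          hf (h1 t ht)
        exact ⟨t', (hS t').2 (h2 t' ht'), h3, h4⟩
      obtain ⟨t', ht', hst, htt⟩ := hup ρ₁ t ht
      obtain ⟨u', hu', hsu, huu⟩ := hup ρ₂ u hu
      refine ⟨t', u', ht', hu', hst, hsu, fun h => ?_, fun h => ?_⟩
      · rcases List.prefix_or_prefix_of_prefix (htt.trans h) huu with h | h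
        exacts [htu h, hut h]
      · rcases List.prefix_or_prefix_of_prefix (huu.trans h) htt with h | h
        exacts [hut h, htu h]

/-! ### The meaning of the formulas on trees -/

theorem exists_betaVal_eq_fun (f : ℕ → ℕ) (n : ℕ) : ∃ a b, ∀ i < n, betaVal a b i = f i := by
  obtain ⟨a, b, h⟩ := exists_betaVal_eq ((List.range n).map f)
  exact ⟨a, b, fun i hi => (h i (by simpa using hi)).trans (by simp)⟩

theorem encode_drop_eq {s : List ℕ} {i x u : ℕ}
    (h : Encodable.encode (s.drop i) = Nat.pair x u + 1) :
    i < s.length ∧ s.getD i 0 = x ∧ Encodable.encode (s.drop (i + 1)) = u := by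
  have hi : i < s.length := by
    by_contra hi
    rw [List.drop_eq_nil_of_le (by omega)] at h
    simp at h
  rw [List.drop_eq_getElem_cons hi, Encodable.encode_list_cons] at h
  obtain ⟨h1, h2⟩ := Nat.pair_eq_pair.1 (Nat.succ.inj h)
  exact ⟨hi, by rw [List.getD_eq_getElem _ _ hi]; exact h1, h2⟩

theorem encode_drop {s : List ℕ} {i : ℕ} (h : i < s.length) : Encodable.encode (s.drop i) =
    Nat.pair (s.getD i 0) (Encodable.encode (s.drop (i + 1))) + 1 := by
  rw [List.drop_eq_getElem_cons h, Encodable.encode_list_cons, List.getD_eq_getElem _ _ h]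
  rfl

/-- A number sequence that starts at the code of `s` and follows the tail rule has no freedom: it
lists the codes of the iterated tails. -/
theorem eq_encode_drop {s : List ℕ} {A : ℕ → ℕ} {l : ℕ} (h0 : A 0 = Encodable.encode s)
    (h : ∀ j < l, ∃ x, A j = Nat.pair x (A (j + 1)) + 1) :
    ∀ j ≤ l, A j = Encodable.encode (s.drop j) := by
  intro j hj
  induction j with
  | zero => simpa using h0
  | succ j ih =>
    obtain ⟨x, hx⟩ := h j (by omega)
    exact ((encode_drop_eq ((ih (by omega)).symm.trans hx)).2.2).symm

theorem length_le_of_encode_drop {s : List ℕ} {l : ℕ} (h : Encodable.encode (s.drop l) = 0) :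
    s.length ≤ l := by
  by_contra hl
  rw [encode_drop (by omega)] at h
  omega

section

variable {n k : ℕ} (S : Set (Set ℕ)) (v : Fin n → ℕ) (V : Fin k → Set ℕ)

theorem sat_isPrefix (s t : Term n) {σ τ : List ℕ} (hs : s.nval v = Encodable.encode σ)
    (ht : t.nval v = Encodable.encode τ) :
    (isPrefix s t : Form n k).sat S v V ↔ σ <+: τ := by
  simp only [isPrefix, sat_ex, sat_and, sat_betaEq, sat_all, sat_imp, sat_lt, sat_pairEq,
    Term.nval_up, Term.nval_last, Term.nval_zero, Term.nval_one, Term.nval_add, hs, ht]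
  constructor
  · rintro ⟨a, b, c, d, l, h1, h2, h3, h⟩
    have hA := eq_encode_drop (A := betaVal a b) h1 fun j hj => by
      obtain ⟨x, u, w, p, q, rfl, rfl, h4, h5, -⟩ := h j hj
      exact ⟨x, by rw [h4, h5]⟩
    have hB := eq_encode_drop (A := betaVal c d) h3 fun j hj => by
      obtain ⟨x, u, w, p, q, rfl, rfl, -, -, h4, h5⟩ := h j hj
      exact ⟨x, by rw [h4, h5]⟩
    -- The final value `0` codes the empty list, so every entry of `σ` is compared.
    have hl := length_le_of_encode_drop ((hA l le_rfl).symm.trans h2)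
    refine List.prefix_iff_getElem?.2 fun i hi => ?_
    obtain ⟨x, u, w, p, q, rfl, rfl, h4, -, h5, -⟩ := h i (by omega)
    obtain ⟨hi1, hx1, -⟩ := encode_drop_eq ((hA i (by omega)).symm.trans h4)
    obtain ⟨hi2, hx2, -⟩ := encode_drop_eq ((hB i (by omega)).symm.trans h5)
    rw [List.getD_eq_getElem _ _ hi1] at hx1
    rw [List.getD_eq_getElem _ _ hi2] at hx2
    rw [List.getElem?_eq_getElem hi2, hx1, hx2]
  · intro h
    obtain ⟨a, b, hA⟩ := exists_betaVal_eq_fun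
      (fun j => Encodable.encode (σ.drop j)) (σ.length + 1)
    obtain ⟨c, d, hB⟩ := exists_betaVal_eq_fun
      (fun j => Encodable.encode (τ.drop j)) (σ.length + 1)
    refine ⟨a, b, c, d, σ.length, by simp [hA], by simp [hA], by simp [hB], fun j hj =>
      ⟨_, _, _, _, _, rfl, rfl, (hA j (by omega)).trans (encode_drop hj),
        hA (j + 1) (by omega), (hB j (by omega)).trans ?_, hB (j + 1) (by omega)⟩⟩
    have hj' := hj.trans_le h.length_le
    rw [encode_drop hj', List.getD_eq_getElem _ _ hj, List.getD_eq_getElem _ _ hj',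
      h.getElem hj]

theorem sat_isInitSeg (s : Term n) (f : Fin k) {σ : List ℕ}
    (hs : s.nval v = Encodable.encode σ) :
    (isInitSeg s f : Form n k).sat S v V ↔ InitSeg σ (V f) := by
  simp only [isInitSeg, sat_ex, sat_and, sat_betaEq, sat_all, sat_imp, sat_lt, sat_pairEq,
    sat_pairMem, Term.nval_up, Term.nval_last, Term.nval_zero, Term.nval_one, Term.nval_add, hs]
  constructor
  · rintro ⟨a, b, l, h1, h2, h⟩
    have hA := eq_encode_drop (A := betaVal a b) h1 fun j hj => by
      obtain ⟨x, u, p, rfl, h4, h5, -⟩ := h j hj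
      exact ⟨x, by rw [h4, h5]⟩
    have hl := length_le_of_encode_drop ((hA l le_rfl).symm.trans h2)
    intro i hi
    obtain ⟨x, u, p, rfl, h4, -, h5⟩ := h i (by omega)
    rwa [(encode_drop_eq ((hA i (by omega)).symm.trans h4)).2.1]
  · intro h
    obtain ⟨a, b, hA⟩ := exists_betaVal_eq_fun
      (fun j => Encodable.encode (σ.drop j)) (σ.length + 1)
    exact ⟨a, b, σ.length, by simp [hA], by simp [hA], fun j hj =>
      ⟨_, _, _, rfl, (hA j (by omega)).trans (encode_drop hj), hA (j + 1) (by omega), h j hj⟩⟩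

theorem exists_encode_eq (m : ℕ) : ∃ s : List ℕ, Encodable.encode s = m :=
  ⟨Denumerable.ofNat (List ℕ) m, Denumerable.encode_ofNat m⟩

theorem forall_nat_iff_forall_list {p : ℕ → Prop} :
    (∀ m, p m) ↔ ∀ s : List ℕ, p (Encodable.encode s) :=
  ⟨fun h _ => h _, fun h m => by
    obtain ⟨s, rfl⟩ := exists_encode_eq m
    exact h s⟩

theorem exists_nat_iff_exists_list {p : ℕ → Prop} :
    (∃ m, p m) ↔ ∃ s : List ℕ, p (Encodable.encode s) :=
  ⟨fun ⟨m, h⟩ => by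
    obtain ⟨s, rfl⟩ := exists_encode_eq m
    exact ⟨s, h⟩, fun ⟨_, h⟩ => ⟨_, h⟩⟩

theorem sat_isFunction (f : Fin k) :
    (isFunction f : Form n k).sat S v V ↔ IsFunctionGraph (V f) := by
  simp [isFunction, IsFunctionGraph]

theorem sat_isTree (T : Fin k) : (isTree T : Form n k).sat S v V ↔
    ∀ s t : List ℕ, s <+: t → Encodable.encode t ∈ V T → Encodable.encode s ∈ V T := by
  simp only [isTree, sat_all]
  rw [forall_nat_iff_forall_list]
  refine forall_congr' fun s => ?_
  rw [forall_nat_iff_forall_list]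
  refine forall_congr' fun t => ?_
  rw [sat_imp, sat_and, sat_isPrefix (σ := s) (τ := t) _ _ _ _ _ (by simp) (by simp)]
  simp only [sat_mem, Term.nval_up, Term.nval_last]
  tauto

theorem sat_isPath (f T : Fin k) : (isPath f T : Form n k).sat S v V ↔
    IsFunctionGraph (V f) ∧ ∀ s : List ℕ, InitSeg s (V f) → Encodable.encode s ∈ V T := by
  rw [isPath, sat_and, sat_isFunction, sat_all, forall_nat_iff_forall_list]
  refine and_congr_right fun _ => forall_congr' fun s => ?_
  rw [sat_imp, sat_isInitSeg (σ := s) _ _ _ _ _ (by simp)]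
  simp only [sat_mem, Term.nval_last]

theorem sat_isCofinal (T : Fin k) : (isCofinal T : Form n k).sat S v V ↔
    ∀ X ∈ S, ∃ f ∈ S, (IsFunctionGraph f ∧
      ∀ s : List ℕ, InitSeg s f → Encodable.encode s ∈ V T) ∧ TuringLE X f := by
  simp only [isCofinal, sat_allS, sat_exS, sat_and, sat_isPath, sat_turingLE, snoc_last,
    snoc_castSucc]

theorem sat_isPerfectTree (T : Fin k) : (isPerfectTree T : Form n k).sat S v V ↔
    (∀ s t : List ℕ, s <+: t → Encodable.encode t ∈ V T → Encodable.encode s ∈ V T) ∧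
    (∃ s : List ℕ, Encodable.encode s ∈ V T) ∧
    ∀ s : List ℕ, Encodable.encode s ∈ V T → ∃ t u : List ℕ, Encodable.encode t ∈ V T ∧
      Encodable.encode u ∈ V T ∧ s <+: t ∧ s <+: u ∧ ¬ t <+: u ∧ ¬ u <+: t := by
  simp only [isPerfectTree, sat_and, sat_isTree]
  refine and_congr_right fun _ => and_congr ?_ ?_
  · simp only [sat_ex]
    rw [exists_nat_iff_exists_list]
    simp only [sat_mem, Term.nval_last]
  · simp only [sat_all, sat_imp, sat_ex]
    rw [forall_nat_iff_forall_list]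
    refine forall_congr' fun s => ?_
    simp only [sat_mem, Term.nval_last]
    refine imp_congr_right fun _ => ?_
    rw [exists_nat_iff_exists_list]
    refine exists_congr fun t => ?_
    rw [exists_nat_iff_exists_list]
    refine exists_congr fun u => ?_
    simp only [sat_and, sat_neg]
    rw [sat_isPrefix (σ := s) (τ := t) _ _ _ _ _ (by simp) (by simp),
      sat_isPrefix (σ := s) (τ := u) _ _ _ _ _ (by simp) (by simp),
      sat_isPrefix (σ := t) (τ := u) _ _ _ _ _ (by simp) (by simp),
      sat_isPrefix (σ := u) (τ := t) _ _ _ _ _ (by simp) (by simp)]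
    simp only [sat_mem, Term.nval_last, Term.nval_up]

end

theorem omegaModel_satisfies_wMPT {S : Set (Set ℕ)} : (omegaModel S).Satisfies wMPT ↔
    ∀ T ∈ S, (∀ s t : List ℕ, s <+: t → Encodable.encode t ∈ T → Encodable.encode s ∈ T) →
      (∀ X ∈ S, ∃ f ∈ S, (IsFunctionGraph f ∧
        ∀ s : List ℕ, InitSeg s f → Encodable.encode s ∈ T) ∧ TuringLE X f) →
      ∃ P ∈ S, ((∀ s t : List ℕ, s <+: t → Encodable.encode t ∈ P → Encodable.encode s ∈ P) ∧
        (∃ s : List ℕ, Encodable.encode s ∈ P) ∧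
        ∀ s : List ℕ, Encodable.encode s ∈ P → ∃ t u : List ℕ, Encodable.encode t ∈ P ∧
          Encodable.encode u ∈ P ∧ s <+: t ∧ s <+: u ∧ ¬ t <+: u ∧ ¬ u <+: t) ∧
        ∀ m ∈ P, m ∈ T := by
  have h0 : ∀ T : Set ℕ, snoc Fin.elim0 T (0 : Fin 1) = T := fun _ => rfl
  have h1 : ∀ T P : Set ℕ, snoc (snoc Fin.elim0 T) P (1 : Fin 2) = P := fun _ _ => rfl
  have h2 : ∀ T P : Set ℕ, snoc (snoc Fin.elim0 T) P (0 : Fin 2) = T := fun _ _ => rfl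
  rw [omegaModel_satisfies]
  simp only [wMPT, sat_allS, sat_imp, sat_and, sat_exS, sat_isTree, sat_isCofinal,
    sat_isPerfectTree, isSubset, sat_all, sat_mem, Term.nval_last, h0, h1, h2, and_imp]

/-! ### The axiom schemes in `ω`-models -/

theorem snoc_comp_castSucc {α : Type} {n : ℕ} (v : Fin n → α) (a : α) :
    snoc v a ∘ Fin.castSucc = v := by
  funext i
  simp

theorem sat_closeN (S : Set (Set ℕ)) {n k : ℕ} (φ : Form n k) (V : Fin k → Set ℕ) :
    φ.closeN.sat S Fin.elim0 V ↔ ∀ v, φ.sat S v V := by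
  induction n with
  | zero => exact ⟨fun h v => Subsingleton.elim Fin.elim0 v ▸ h, fun h => h _⟩
  | succ n ih =>
    refine (ih φ.allN).trans ⟨fun h v => ?_, fun h v a => h _⟩
    have := h (v ∘ Fin.castSucc) (v (Fin.last n))
    rwa [show snoc (v ∘ Fin.castSucc) (v (Fin.last n)) = v from Fin.snoc_init_self v] at this

theorem sat_closeS (S : Set (Set ℕ)) {k : ℕ} (φ : Form 0 k) :
    φ.closeS.sat S Fin.elim0 Fin.elim0 ↔
      ∀ V : Fin k → Set ℕ, (∀ i, V i ∈ S) → φ.sat S Fin.elim0 V := by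
  induction k with
  | zero => exact ⟨fun h V _ => Subsingleton.elim Fin.elim0 V ▸ h, fun h => h _ fun i => i.elim0⟩
  | succ k ih =>
    refine (ih φ.allS).trans ⟨fun h V hV => ?_, fun h V hV A hA => h _ fun i => ?_⟩
    · have := h (V ∘ Fin.castSucc) (fun i => hV _) (V (Fin.last k)) (hV _)
      rwa [show snoc (V ∘ Fin.castSucc) (V (Fin.last k)) = V from Fin.snoc_init_self V] at this
    · refine Fin.lastCases ?_ (fun i => ?_) i
      · simpa using hA
      · simpa using hV i

theorem omegaModel_satisfies_close (S : Set (Set ℕ)) {n k : ℕ} (φ : Form n k) :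
    (omegaModel S).Satisfies φ.close ↔
      ∀ V : Fin k → Set ℕ, (∀ i, V i ∈ S) → ∀ v, φ.sat S v V := by
  rw [omegaModel_satisfies, Form.close, sat_closeS]
  simp only [sat_closeN]

theorem omegaModel_satisfies_comprehensionAxiom (S : Set (Set ℕ)) {p q : ℕ}
    (φ : Form (p + 1) q) : (omegaModel S).Satisfies (comprehensionAxiom φ) ↔
      ∀ V : Fin q → Set ℕ, (∀ i, V i ∈ S) → ∀ v : Fin p → ℕ,
        ∃ A ∈ S, ∀ m, m ∈ A ↔ φ.sat S (snoc v m) V := by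
  rw [comprehensionAxiom, omegaModel_satisfies_close]
  simp only [sat_exS, sat_all, sat_iff, sat_mem, Term.nval_last, snoc_last, Form.sat_rename,
    snoc_comp_castSucc, Function.comp_id]

theorem omegaModel_satisfies_basicAxioms (S : Set (Set ℕ)) :
    (omegaModel S).SatisfiesAll basicAxioms := by
  intro σ hσ
  rw [omegaModel_satisfies]
  simp only [basicAxioms, Set.mem_ofPred_eq, List.mem_cons, List.not_mem_nil, or_false] at hσ
  rcases hσ with rfl | rfl | rfl | rfl | rfl | rfl | rfl | rfl <;>
    simp only [sat_all, sat_neg, sat_imp, sat_iff, sat_or, sat_eq, sat_lt, Term.nval_up,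
      Term.nval_last, Term.nval_zero, Term.nval_one, Term.nval_add, Term.nval_mul] <;> intros
  all_goals first | omega | ring

theorem omegaModel_satisfies_inductionAxiom (S : Set (Set ℕ)) :
    (omegaModel S).Satisfies inductionAxiom := by
  rw [omegaModel_satisfies]
  have h0 : ∀ T : Set ℕ, snoc Fin.elim0 T (0 : Fin 1) = T := fun _ => rfl
  simp only [inductionAxiom, sat_allS, sat_imp, sat_and, sat_all, sat_mem, Term.nval_last,
    Term.nval_zero, Term.nval_one, Term.nval_add, h0]
  rintro A - ⟨hz, hs⟩ n
  induction n with
  | zero => exact hz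
  | succ n ih => exact hs n ih

theorem omegaModel_satisfiesAll_ACA0 {S : Set (Set ℕ)} (h : ∀ (p q : ℕ) (φ : Form (p + 1) q),
    φ.IsArithmetical → ∀ V : Fin q → Set ℕ, (∀ i, V i ∈ S) → ∀ v : Fin p → ℕ,
      {m | φ.sat Set.univ (snoc v m) V} ∈ S) : (omegaModel S).SatisfiesAll ACA0 := by
  rintro σ ((hσ | rfl) | ⟨p, q, φ, hφ, rfl⟩)
  · exact omegaModel_satisfies_basicAxioms S σ hσ
  · exact omegaModel_satisfies_inductionAxiom S
  · refine (omegaModel_satisfies_comprehensionAxiom S φ).2 fun V hV v =>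
      ⟨_, h p q φ hφ V hV v, fun m => φ.sat_of_isArithmetical _ _ hφ _ _⟩

/-! ### The natural order as a well-ordering, and transfinite recursion along it -/

/-- The order `<` of the linear order coded by `X`. -/
def LtIn (X : Set ℕ) (i j : ℕ) : Prop := Nat.pair i j ∈ X ∧ Nat.pair j i ∉ X

theorem sat_ltIn {n k : ℕ} (S : Set (Set ℕ)) (v : Fin n → ℕ) (V : Fin k → Set ℕ) (i j : Term n)
    (X : Fin k) : (ltIn i j X).sat S v V ↔ LtIn (V X) (i.nval v) (j.nval v) := by
  simp only [ltIn, LtIn, sat_and, sat_neg, sat_pairMem]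

/-- The set `{⟨i, j⟩ | i ≤ j}`. -/
def natOrder : Set ℕ := {z | z.unpair.1 ≤ z.unpair.2}

theorem pair_mem_natOrder {i j : ℕ} : Nat.pair i j ∈ natOrder ↔ i ≤ j := by
  simp [natOrder]

theorem sat_isWellOrder_of_eq {n k : ℕ} (S : Set (Set ℕ)) (v : Fin n → ℕ) (V : Fin k → Set ℕ)
    (X : Fin k) (hX : V X = natOrder) : (isWellOrder X : Form n k).sat S v V := by
  simp only [isWellOrder, isLinearOrder, sat_and, sat_all, sat_imp, sat_or, sat_eq, sat_neg,
    sat_exS, sat_pairMem, sat_isFunction, sat_ltIn, Term.nval_up, Term.nval_last, Term.nval_add,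
    Term.nval_one, snoc_last, snoc_castSucc, hX, pair_mem_natOrder, LtIn]
  refine ⟨⟨fun i j _ => ⟨le_rfl, le_rfl⟩, fun i j l h => h.1.trans h.2,
    fun i j h => le_antisymm h.1 h.2, fun i j _ => le_total i j⟩, ?_⟩
  rintro ⟨f, -, hf, h⟩
  obtain ⟨F, hF, -⟩ := hf.exists_eq
  -- An infinite descent from `F 0` would have more than `F 0` steps. No descending function exists
  -- at all, so the choice of `S` is irrelevant.
  have hlt : ∀ i, F (i + 1) < F i := fun i =>
    not_le.1 (h i _ _ ⟨(hF _ _).2 rfl, (hF _ _).2 rfl⟩).2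
  have hle : ∀ i, F i + i ≤ F 0 := fun i => by
    induction i with
    | zero => exact le_rfl
    | succ i ih => have := hlt i; omega
  have := hle (F 0 + 1)
  omega

theorem omegaModel_satisfies_atrAxiom {S : Set (Set ℕ)} {θ : Form 1 1}
    (h : (omegaModel S).Satisfies (atrAxiom (p := 0) (q := 0) θ)) (hS : natOrder ∈ S) :
    ∃ Y ∈ S, ∀ j, ∃ Z, (∀ z, z ∈ Z ↔ z ∈ Y ∧ z.unpair.2 < j) ∧
      ∀ m, Nat.pair m j ∈ Y ↔ θ.sat S (fun _ => m) (fun _ => Z) := by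
  rw [atrAxiom, omegaModel_satisfies_close] at h
  have h := h Fin.elim0 (fun i => i.elim0) Fin.elim0
  rw [sat_allS] at h
  have h := h natOrder hS
  rw [sat_imp] at h
  have h := h (sat_isWellOrder_of_eq _ _ _ _ (snoc_last _ _))
  simp only [sat_exS, sat_and, sat_all, sat_imp, sat_iff, sat_mem, sat_ex, sat_pairEq, sat_pairMem,
    isInitialPart, sat_ltIn, Form.sat_rename, snoc_comp_extendMap, Term.nval_up, Term.nval_last,
    snoc_last, snoc_castSucc, pair_mem_natOrder, LtIn, le_refl, true_imp_iff] at h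
  obtain ⟨Y, hY, -, h⟩ := h
  refine ⟨Y, hY, fun j => ?_⟩
  obtain ⟨Z, -, h1, h2⟩ := h j
  refine ⟨Z, fun z => (h1 z).trans (and_congr_right fun _ => ?_), fun m => (h2 m).trans ?_⟩
  · constructor
    · rintro ⟨m, i, rfl, hi⟩
      simpa using hi.2
    · intro hz
      exact ⟨_, _, (Nat.pair_unpair z).symm, hz.le, not_le.2 hz⟩
  · refine iff_of_eq (congrArg₂ _ (funext fun i => ?_) (funext fun i => ?_))
    · rw [(Subsingleton.elim (α := Fin 1) i (Fin.last 0) : i = Fin.last 0), snoc_last]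
    · rw [(Subsingleton.elim (α := Fin 1) i (Fin.last 0) : i = Fin.last 0), snoc_last]

/-! ### The `ω`-model of an iterated generic sequence -/

section Generic

variable {g : ℕ → Set ℕ}

theorem ArithmeticalIn.joinUpTo_mono {X : Set ℕ} {m n : ℕ} (h : ArithmeticalIn X (joinUpTo g m))
    (hmn : m ≤ n) : ArithmeticalIn X (joinUpTo g n) :=
  h.trans (turingLE_joinUpTo g hmn).arithmeticalIn

theorem genericIdeal_satisfies_ACA0 (g : ℕ → Set ℕ) :
    (omegaModel (genericIdeal g)).SatisfiesAll ACA0 := by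
  refine omegaModel_satisfiesAll_ACA0 fun p q φ hφ V hV v => ?_
  simp only [mem_genericIdeal] at hV ⊢
  choose n hn using hV
  refine ⟨Finset.univ.sup n, ?_⟩
  have hA : Arith fun (m : ℕ) (V : Fin (q + 1) → Set ℕ) =>
      φ.sat Set.univ (snoc v m) (V ∘ Fin.castSucc) :=
    (Arith.sat_comp φ hφ Fin.castSucc).comp
      (primrec_snoc.comp ((Primrec.const v).pair .id)).to_comp
  -- The empty set fills the extra set variable that `Arith` requires, as there may be no set
  -- parameters. All real parameters are arithmetical in the longest join among those chosen for
  -- them.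
  have hV : ∀ i, ArithmeticalIn (snoc V ∅ i) (joinUpTo g (Finset.univ.sup n)) := fun i => by
    refine Fin.lastCases ?_ (fun i => ?_) i
    · rw [snoc_last]
      exact (turingLE_empty _).arithmeticalIn
    · rw [snoc_castSucc]
      exact (hn i).joinUpTo_mono (Finset.le_sup (Finset.mem_univ i))
  have h := hA.arithmeticalIn hV
  rwa [snoc_comp_castSucc] at h

theorem IteratedGeneric.not_arithmeticalIn (hg : IteratedGeneric g) (n : ℕ) :
    ¬ ArithmeticalIn (g (n + 1)) (joinUpTo g n) :=
  (hg.2 n).not_arithmeticalIn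

theorem genericIdeal_satisfies_wMPT (hg : IteratedGeneric g) :
    (omegaModel (genericIdeal g)).Satisfies wMPT := by
  classical
  refine omegaModel_satisfies_wMPT.2 fun T hT _ hcof => ?_
  obtain ⟨n, hn⟩ := mem_genericIdeal.1 hT
  -- Cofinality is applied to the first generic beyond the stage where `T` appears, to obtain a path
  -- that is not arithmetical at that stage.
  obtain ⟨f, hf, ⟨hfun, hpath⟩, hle⟩ := hcof (g (n + 1)) (mem_genericIdeal.2
    ⟨n + 1, (turingLE_join_right _ _).arithmeticalIn⟩)
  have hfn : ¬ ArithmeticalIn f (joinUpTo g n) := fun h =>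
    hg.not_arithmeticalIn n (hle.arithmeticalIn.trans h)
  have hex := mem_genericIdeal.1 hf
  -- At the least stage defining `f`, exactly the last generic is responsible: `f` is not
  -- arithmetical in the join before it. That stage comes after `n`, so `T` is already available
  -- there.
  obtain ⟨m, hm⟩ : ∃ m, Nat.find hex = m + 1 := Nat.exists_eq_succ_of_ne_zero fun h =>
    hfn ((h ▸ Nat.find_spec hex).joinUpTo_mono (Nat.zero_le n))
  have hfm : ArithmeticalIn f (join (joinUpTo g m) (g (m + 1))) := by
    have := Nat.find_spec hex
    rwa [hm] at this
  have hnm : n ≤ m := by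
    by_contra h
    exact hfn (ArithmeticalIn.joinUpTo_mono (m := m + 1) hfm (by omega))
  obtain ⟨S, hS, h1, h2, h3, h4⟩ := exists_perfect_subtree (hg.2 m) (hn.joinUpTo_mono hnm) hfm
    hfun hpath (Nat.find_min hex (by omega))
  refine ⟨S, mem_genericIdeal.2 ⟨m, hS⟩, ⟨h2, h1, h4⟩, fun m hm => ?_⟩
  obtain ⟨s, rfl⟩ := exists_encode_eq m
  exact h3 s hm

/-! ### Implicitly definable sets, the `ω`-jump and the failure of `ATR₀` -/

/-- The model contains no set that computes a jump chain and is the only one with some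
arithmetical property. -/
theorem IteratedGeneric.notMem_genericIdeal (hg : IteratedGeneric g) {W : Set ℕ}
    {Ψ : Unit → (Fin 1 → Set ℕ) → Prop} (hΨ : Arith Ψ) (hW : Ψ () fun _ => W)
    (hu : ∀ W', Ψ () (fun _ => W') → W' = W) {C : ℕ → Set ℕ} (hC : JumpChain C)
    (hCW : ∀ i, TuringLE (C i) W) : W ∉ genericIdeal g := by
  rw [mem_genericIdeal]
  rintro ⟨n, hn⟩
  refine hC.not_arithmeticalIn hCW (turingLE_empty _) (?_ : ArithmeticalIn W ∅)
  induction n with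
  | zero =>
    -- The bottom generic is regarded as an extension of the empty set.
    exact (hn.trans (turingLE_join_right ∅ _).arithmeticalIn).of_join_of_unique hg.1 hΨ hW hu
  | succ n ih => exact ih (ArithmeticalIn.of_join_of_unique (hg.2 n) hΨ hW hu hn)

theorem forall_nat_iff_forall_pair {p : ℕ → Prop} : (∀ z, p z) ↔ ∀ j n, p (Nat.pair n j) :=
  ⟨fun h _ _ => h _, fun h z => Nat.pair_unpair z ▸ h _ _⟩

theorem emptyOmegaJump_notMem_genericIdeal (hg : IteratedGeneric g) :
    emptyOmegaJump ∉ genericIdeal g := by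
  have hW : ∀ j n, Nat.pair n j ∈ emptyOmegaJump ↔ n ∈ jump^[j] ∅ := fun j n => by
    simp [emptyOmegaJump]
  have hP : Arith fun (p : ℕ × ℕ) (V : Fin 1 → Set ℕ) =>
      p.1 ∈ jump {m | Nat.pair m p.2 ∈ V 0} :=
    ((Arith.mem_jump (k := 0) 0).comp Computable.fst).subst
      (Q := fun _ (p : (ℕ × ℕ) × ℕ) V => Nat.pair p.2 p.1.2 ∈ V 0) fun _ =>
        Arith.mem 0 (Primrec₂.natPair.comp .snd (Primrec.snd.comp .fst)).to_comp
  have hz : Primrec fun p : (Unit × ℕ) × ℕ => p.1.2.unpair :=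
    Primrec.unpair.comp (Primrec.snd.comp .fst)
  -- The implicit definition of `∅^(ω)`: column `0` is empty and column `i + 1` is the jump of
  -- column `i`. It determines the columns by induction.
  have hΨ : Arith fun (_ : Unit) (V : Fin 1 → Set ℕ) => ∀ z : ℕ, z ∈ V 0 ↔
      ∃ i, z.unpair.2 = i + 1 ∧ z.unpair.1 ∈ jump {m | Nat.pair m i ∈ V 0} :=
    ((Arith.mem 0 Computable.snd).iff
      ((Arith.eq_nat (Primrec.snd.comp hz).to_comp (Primrec.succ.comp .snd).to_comp).and
        (hP.comp ((Primrec.fst.comp hz).pair .snd).to_comp)).ex).all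
  refine hg.notMem_genericIdeal hΨ ?_ ?_ (jumpChain_iterate ∅) fun i =>
    .of_computable (Primrec₂.natPair.comp .id (.const i)).to_comp fun n => (hW i n).symm
  · refine forall_nat_iff_forall_pair.2 fun j n => ?_
    simp only [Nat.unpair_pair, hW]
    rcases j with _ | j
    · simp
    · simp [Function.iterate_succ_apply', -Function.iterate_succ]
  · intro W' hW'
    have hW' := forall_nat_iff_forall_pair.1 hW'
    simp only [Nat.unpair_pair] at hW'
    suffices H : ∀ j n, Nat.pair n j ∈ W' ↔ n ∈ jump^[j] ∅ from
      Set.ext (forall_nat_iff_forall_pair.2 fun j n => (H j n).trans (hW j n).symm)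
    intro j
    induction j with
    | zero =>
      intro n
      rw [hW']
      simp
    | succ j ih =>
      intro n
      have : {m | Nat.pair m j ∈ W'} = jump^[j] ∅ := Set.ext ih
      rw [hW']
      simp [this, Function.iterate_succ_apply', -Function.iterate_succ]

/-- The formula saying that the number variable belongs to the jump of the set variable. -/
def jumpForm : Form 1 1 :=
  Form.ex fun y => computes 0 (Term.up (Term.var 0)) (Term.up (Term.var 0)) y

theorem isArithmetical_jumpForm : jumpForm.IsArithmetical := by
  repeat' constructor

theorem sat_jumpForm (S : Set (Set ℕ)) (m : ℕ) (Z : Set ℕ) :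
    jumpForm.sat S (fun _ => m) (fun _ => Z) ↔ m ∈ jump Z := by
  simp only [jumpForm, sat_ex, sat_computes_iff, Term.nval_up, Term.nval_last, nval_var_const,
    mem_jump]

theorem not_satisfiesAll_ATR0 (hg : IteratedGeneric g) :
    ¬ (omegaModel (genericIdeal g)).SatisfiesAll ATR0 := by
  intro h
  have hprim : ∀ j : ℕ, PrimrecPred fun z : ℕ => z.unpair.2 < j := fun j =>
    Primrec.nat_lt.comp (Primrec.snd.comp Primrec.unpair) (.const j)
  have hdec : ∀ (C : Set ℕ) {p : ℕ → Prop}, PrimrecPred p → TuringLE {z | p z} C := fun C p hp => by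
    simpa [DecidableIn] using DecidableIn.of_primrecPred (C := C) hp
  have hS : natOrder ∈ genericIdeal g := mem_genericIdeal.2 ⟨0, (hdec _ (Primrec.nat_le.comp
    (Primrec.fst.comp Primrec.unpair) (Primrec.snd.comp Primrec.unpair))).arithmeticalIn⟩
  obtain ⟨Y, hY, hYZ⟩ := omegaModel_satisfies_atrAxiom
    (h _ (.inr ⟨0, 0, jumpForm, isArithmetical_jumpForm, rfl⟩)) hS
  -- The recursion instance makes column `j` of `Y` the jump of the part of `Y` in the columns below
  -- `j`. This condition is arithmetical and determines `Y` by strong induction on `j`.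
  have hY' : ∀ j m, Nat.pair m j ∈ Y ↔ m ∈ jump {z | z ∈ Y ∧ z.unpair.2 < j} := fun j m => by
    obtain ⟨Z, hZ, hj⟩ := hYZ j
    rw [hj m, sat_jumpForm, show Z = {z | z ∈ Y ∧ z.unpair.2 < j} from Set.ext hZ]
  have hP : Arith fun (p : ℕ × ℕ) (V : Fin 1 → Set ℕ) =>
      p.1 ∈ jump {w | w ∈ V 0 ∧ w.unpair.2 < p.2} :=
    ((Arith.mem_jump (k := 0) 0).comp Computable.fst).subst
      (Q := fun _ (p : (ℕ × ℕ) × ℕ) V => p.2 ∈ V 0 ∧ p.2.unpair.2 < p.1.2) fun _ =>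
        (Arith.mem 0 Computable.snd).and (Arith.lt_nat
          (Primrec.snd.comp (Primrec.unpair.comp .snd)).to_comp (Primrec.snd.comp .fst).to_comp)
  have hΨ : Arith fun (_ : Unit) (V : Fin 1 → Set ℕ) => ∀ z : ℕ, z ∈ V 0 ↔
      z.unpair.1 ∈ jump {w | w ∈ V 0 ∧ w.unpair.2 < z.unpair.2} :=
    ((Arith.mem 0 Computable.snd).iff
      (hP.comp (Primrec.unpair.comp .snd).to_comp)).all
  refine hg.notMem_genericIdeal hΨ ?_ ?_ (C := fun j => {z | z ∈ Y ∧ z.unpair.2 < j}) ?_ ?_ hY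
  · refine forall_nat_iff_forall_pair.2 fun j n => ?_
    simpa only [Nat.unpair_pair] using hY' j n
  · intro W hW
    have hW := forall_nat_iff_forall_pair.1 hW
    simp only [Nat.unpair_pair] at hW
    suffices H : ∀ j n, Nat.pair n j ∈ W ↔ Nat.pair n j ∈ Y from
      Set.ext (forall_nat_iff_forall_pair.2 H)
    intro j
    induction j using Nat.strong_induction_on with
    | _ j ih =>
      intro n
      rw [hW, hY', show {w | w ∈ W ∧ w.unpair.2 < j} = {z | z ∈ Y ∧ z.unpair.2 < j} from
        Set.ext fun z => and_congr_left fun hz => by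
          simpa using ih z.unpair.2 hz z.unpair.1]
  -- The part of `Y` below `j + 1` contains column `j`, which is the jump of the part below `j`; so
  -- these parts form a jump chain, and `Y` computes each of them.
  · intro j
    refine .of_computable (Primrec₂.natPair.comp .id (.const j)).to_comp fun n => ?_
    refine (hY' j n).symm.trans ?_
    simp
  · exact fun j => (TuringLE.refl Y).inter (hdec Y (hprim j))

end Generic

end SOA

/-! ### The separation of `wMPT` from `ATR₀` -/

theorem mainTheorem5 :
    (∃ σ ∈ SOA.ATR0, ¬ SOA.Entails (SOA.ACA0 ∪ {SOA.wMPT}) σ) ∧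
    (∃ g : ℕ → Set ℕ, SOA.IteratedGeneric g) ∧
    ∀ g : ℕ → Set ℕ, SOA.IteratedGeneric g →
      (SOA.omegaModel (SOA.genericIdeal g)).SatisfiesAll SOA.ACA0 ∧
      (SOA.omegaModel (SOA.genericIdeal g)).Satisfies SOA.wMPT ∧
      SOA.emptyOmegaJump ∉ SOA.genericIdeal g ∧
      ¬ (SOA.omegaModel (SOA.genericIdeal g)).SatisfiesAll SOA.ATR0 := by
  refine ⟨?_, SOA.exists_iteratedGeneric, fun g hg => ⟨SOA.genericIdeal_satisfies_ACA0 g,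
    SOA.genericIdeal_satisfies_wMPT hg, SOA.emptyOmegaJump_notMem_genericIdeal hg,
    SOA.not_satisfiesAll_ATR0 hg⟩⟩
  obtain ⟨g, hg⟩ := SOA.exists_iteratedGeneric
  -- If every axiom of `ATR₀` followed, the generic model would satisfy all of them.
  by_contra! h
  refine SOA.not_satisfiesAll_ATR0 hg fun σ hσ => h σ hσ _ ?_
  rintro τ (hτ | rfl)
  · exact SOA.genericIdeal_satisfies_ACA0 g τ hτ
  · exact SOA.genericIdeal_satisfies_wMPT hg
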